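/- Let $n\ge 2$, let $1\le p<\infty$, and let $(\Omega,\mathcal F,P)$ be a probability space. Let $\mathcal H=GL_n(\mathbb R)$ act on random vectors $x:\Omega\to\mathbb R^n$ by $x\mapsto Hx$, and let $\mathcal T\subset\mathcal H$ be the set of trivial filters $T=\Lambda\Pi$, with $\Lambda$ an invertible diagonal matrix and $\Pi$ a permutation matrix. Let $\mathcal S_p$ be the set of random vectors $s=(s_1,\dots,s_n)$ on $\Omega$ whose components are mutually independent, each have a probability density (with respect to Lebesgue measure) belonging to $L^p(\mathbb R)$, and at most one of which is Gaussian. Let $\mathcal S_p^2\subset\mathcal S_p$ be the subset of those $s$ whose components have finite variance. For a set $\mathcal S$ of random vectors write $\mathcal H\cdot\mathcal S=\{Hs: H\in\mathcal H,\ s\in\mathcal S\}$. For a random vector $y$ with joint density $p_y$ and marginal densities $p_{y_i}$, its Function Difference is $$\Delta_y(u)=\prod_{i=1}^n p_{y_i}(u_i)-p_y(u),\qquad \|\Delta_y\|_p=\Big(\int_{\mathbb R^n}|\Delta_y(u)|^p\,du\Big)^{1/p}.$$ If the components of $y$ have finite non-zero variances, let $\tilde y$ be the vector with components $\tilde y_i=(y_i-\mathbb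 E y_i)/\sigma_{y_i}$. Put $$\Phi_p(H;x)=-\|\Delta_{\widetilde{Hx}}\|_p\ \text{ (with normalization)},\qquad \Phi^0_p(H;x)=-\|\Delta_{Hx}\|_p\ \text{ (without normalization)}.$$ A real-valued map $\Phi$ on $\mathcal H\times(\mathcal H\cdot\mathcal S)$ is a *contrast* on $\mathcal S$ if, for each $H$, $\Phi(H;x)$ depends on $x$ only through its density, and * (invariance) $\Phi(T;x)=\Phi(I;x)$ for all $x\in\mathcal H\cdot\mathcal S$, $T\in\mathcal T$; * (dominance) $\Phi(H;s)\le\Phi(I;s)$ for all $s\in\mathcal S$, $H\in\mathcal H$; * (discrimination) if $s\in\mathcal S$, $H\in\mathcal H$ and $\Phi(H;s)=\Phi(I;s)$, then $H\in\mathcal T$. Then: 1. For every $x\in\mathcal H\cdot\mathcal S_p^2$ the vector $\tilde x$ has a joint density and marginal densities, $\Delta_{\tilde x}\in L^p(\mathbb R^n)$, and $\Phi_p$ is a contrast on $\mathcal S_p^2$. 2. For every $x\in\mathcal H\cdot\mathcal S_p$ the vector $x$ has a joint density and marginal densities, $\Delta_x\in L^p(\mathbb R^n)$, and $\Phi_p^0$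 depends only on the density of $x$, satisfies dominance and discrimination on $\mathcal S_p$, and is relatively scale invariant: $$\Phi^0_p(T;x)=|\det T|^{\frac{1-p}{p}}\,\Phi^0_p(I;x)\quad\text{for all }x\in\mathcal H\cdot\mathcal S_p,\ T\in\mathcal T;$$ moreover $\Phi^0_p(T;s)=\Phi^0_p(I;s)$ for all $s\in\mathcal S_p$, $T\in\mathcal T$. 3. For $p=1$, $\Phi^0_1$ is a contrast on $\mathcal S_1$. -/

import Mathlib

open MeasureTheory ProbabilityTheory

namespace BSS

noncomputable section

/-- Filters of the linear, instantaneous, square model: invertible real matrices. -/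
abbrev LinearFilter (n : ℕ) : Type := Matrix.GeneralLinearGroup (Fin n) ℝ

/-- The random vector `y = H x` obtained by letting the filter `H` act on `x`. -/
def mix {n : ℕ} {Ω : Type*} (H : LinearFilter n) (x : Ω → Fin n → ℝ) : Ω → Fin n → ℝ :=
  fun ω => (H : Matrix (Fin n) (Fin n) ℝ).mulVec (x ω)

/-- The `i`-th component of a random vector. -/
def comp {n : ℕ} {Ω : Type*} (x : Ω → Fin n → ℝ) (i : Fin n) : Ω → ℝ := fun ω => x ω i

/-- The trivial filters: a permutation of the components followed by a scaling of each
component by a non-zero factor. -/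
def trivialFilters (n : ℕ) : Set (LinearFilter n) :=
  {T | ∃ (σ : Equiv.Perm (Fin n)) (t : Fin n → ℝ), (∀ i, t i ≠ 0) ∧
    (T : Matrix (Fin n) (Fin n) ℝ) = Matrix.diagonal t * σ.permMatrix ℝ}

/-- The set `𝓗 · 𝓢` of all mixtures of the random vectors of `S`. -/
def mixtures {n : ℕ} {Ω : Type*} (S : Set (Ω → Fin n → ℝ)) : Set (Ω → Fin n → ℝ) :=
  {x | ∃ (H : LinearFilter n) (s : Ω → Fin n → ℝ), s ∈ S ∧ x = mix H s}

section Measure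

variable {n : ℕ} {Ω : Type*} [MeasurableSpace Ω]

/-- The Function Difference of a random vector: the product of its marginal densities minus
its joint density. -/
def functionDifference (P : Measure Ω) (x : Ω → Fin n → ℝ) (u : Fin n → ℝ) : ℝ :=
  (∏ i, (pdf (comp x i) P volume (u i)).toReal) - (pdf x P volume u).toReal

/-- The `Lᵖ` norm of the Function Difference of a random vector. -/
def fdNorm (p : ℝ) (P : Measure Ω) (x : Ω → Fin n → ℝ) : ℝ :=
  (∫ u : Fin n → ℝ, |functionDifference P x u| ^ p) ^ (1 / p)

/-- Componentwise normalization to zero mean and unit variance. -/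
def normalize (P : Measure Ω) (x : Ω → Fin n → ℝ) : Ω → Fin n → ℝ :=
  fun ω i => (x ω i - ∫ ω', comp x i ω' ∂P) / Real.sqrt (variance (comp x i) P)

/-- `Φ(H; x) = -‖Δ(Hx)‖_p`, without normalization. -/
def rawContrast (p : ℝ) (P : Measure Ω) (H : LinearFilter n) (x : Ω → Fin n → ℝ) : ℝ :=
  -fdNorm p P (mix H x)

/-- `Φ(H; x) = -‖Δ(z)‖_p`, where `z` is the normalization of `y = Hx`. -/
def normalizedContrast (p : ℝ) (P : Measure Ω) (H : LinearFilter n) (x : Ω → Fin n → ℝ) : ℝ :=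
  -fdNorm p P (normalize P (mix H x))

/-- The source vectors: mutually independent components, each with a density in `Lᵖ`,
at most one of them Gaussian. -/
structure IsSource (p : ℝ) (P : Measure Ω) (s : Ω → Fin n → ℝ) : Prop where
  hasPDF : ∀ i, HasPDF (comp s i) P volume
  memLp : ∀ i, MemLp (fun u : ℝ => (pdf (comp s i) P volume u).toReal) (ENNReal.ofReal p) volume
  indep : iIndepFun (fun i => comp s i) P
  gaussian : ∀ i j, HasGaussianLaw (comp s i) P → HasGaussianLaw (comp s j) P → i = j

/-- The class of all source vectors on a probability space. -/
def sources (n : ℕ) (p : ℝ) (P : Measure Ω) : Set (Ω → Fin n → ℝ) :=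
  {s | IsSource p P s}

/-- The class of all source vectors whose components have finite variance. -/
def sourcesL2 (n : ℕ) (p : ℝ) (P : Measure Ω) : Set (Ω → Fin n → ℝ) :=
  {s | IsSource p P s ∧ ∀ i, MemLp (comp s i) 2 P}

/-- The joint and marginal densities of `x` exist, and its Function Difference is in `Lᵖ`, so
that `fdNorm p P x` is the genuine (finite) norm. -/
structure HasFiniteFD (p : ℝ) (P : Measure Ω) (x : Ω → Fin n → ℝ) : Prop where
  joint : HasPDF x P volume
  marginal : ∀ i, HasPDF (comp x i) P volume
  memLp : MemLp (functionDifference P x) (ENNReal.ofReal p) volume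

/-- `Φ(H; x)`, for `x` in `𝓗 · 𝓢`, depends on `x` only through its density. -/
def DependsOnlyOnPDF (P : Measure Ω) (S : Set (Ω → Fin n → ℝ))
    (Φ : LinearFilter n → (Ω → Fin n → ℝ) → ℝ) : Prop :=
  ∀ x ∈ mixtures S, ∀ x' ∈ mixtures S,
    pdf x P volume =ᵐ[volume] pdf x' P volume → ∀ H, Φ H x = Φ H x'

/-- A contrast with source class `S` and set of trivial filters `T`. -/
structure IsContrast (P : Measure Ω) (S : Set (Ω → Fin n → ℝ)) (T : Set (LinearFilter n))
    (Φ : LinearFilter n → (Ω → Fin n → ℝ) → ℝ) : Prop where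
  pdf_only : DependsOnlyOnPDF P S Φ
  invariance : ∀ x ∈ mixtures S, ∀ t ∈ T, Φ t x = Φ 1 x
  dominance : ∀ s ∈ S, ∀ H, Φ H s ≤ Φ 1 s
  discrimination : ∀ s ∈ S, ∀ H, Φ H s = Φ 1 s → H ∈ T

/-- A contrast in the sense of relative scale invariance: on mixtures a trivial filter `t`
multiplies the criterion by the factor `k t`, which does not depend on the random vector, and
on the sources themselves it leaves the criterion unchanged. -/
structure IsRelativeContrast (P : Measure Ω) (S : Set (Ω → Fin n → ℝ)) (T : Set (LinearFilter n))
    (k : LinearFilter n → ℝ) (Φ : LinearFilter n → (Ω → Fin n → ℝ) → ℝ) : Prop where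
  pdf_only : DependsOnlyOnPDF P S Φ
  relative_invariance : ∀ x ∈ mixtures S, ∀ t ∈ T, Φ t x = k t * Φ 1 x
  source_invariance : ∀ s ∈ S, ∀ t ∈ T, Φ t s = Φ 1 s
  dominance : ∀ s ∈ S, ∀ H, Φ H s ≤ Φ 1 s
  discrimination : ∀ s ∈ S, ∀ H, Φ H s = Φ 1 s → H ∈ T

end Measure

end

end BSS

/-! ### Fréchet's functional equation near zero. -/

namespace BSS

open Filter Topology Polynomial

/-! The Function Difference vanishes almost everywhere exactly when the components are independent.
Both criteria are therefore nonpositive and equal to zero on sources, which gives dominance. If a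
filter `H` also attains zero, then `s` and `Hs` both have independent components, and discrimination
becomes the identifiability question of independent component analysis.

That question is settled by Darmois' theorem. Equating the two factorizations of the characteristic
function of `Hs` and taking logarithms near zero gives an equation between sums of functions of
linear forms. If a column of `H` has two non-zero entries, its form is proportional to none of the
others. Differencing eliminates the others, so the logarithm of that source's characteristic
function is a polynomial near zero, and Marcinkiewicz's theorem makes the source Gaussian. With at
most one Gaussian source, each column has a single non-zero entry (`eq_of_iIndepFun_mixture`), so
`H` is trivial.

Finiteness: the joint density of a mixture is a linear change of variables of a tensor product of
`Lᵖ` densities. Each marginal is a scaled source plus an independent variable, and convolution with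
a probability measure preserves `Lᵖ` (`memLp_pdf_add`).

Invariance: a trivial filter `T` multiplies the joint density and the product of the marginals by
the same `|det T|⁻¹`, hence the norm by `|det T| ^ ((1 - p) / p)` (`fdNorm_scale`). Normalization
cancels this factor, because the standard deviations scale by the same `|t i|`. -/

lemma exists_polynomial_derivative_eq (Q : ℂ[X]) : ∃ A : ℂ[X], derivative A = Q := by
  induction Q using Polynomial.induction_on' with
  | add p q hp hq =>
    obtain ⟨A, rfl⟩ := hp
    obtain ⟨B, rfl⟩ := hq
    exact ⟨A + B, derivative_add⟩
  | monomial n a =>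
    refine ⟨monomial (n + 1) (a / (n + 1)), ?_⟩
    have : (n : ℂ) + 1 ≠ 0 := Nat.cast_add_one_ne_zero n
    simp [this]

/-- A function whose derivative is a polynomial near a point is a polynomial near that point. -/
lemma eventually_eq_polynomial_of_hasDerivAt {A A' : ℝ → ℂ} {Q : ℂ[X]}
    (hA : ∀ x, HasDerivAt A (A' x) x) (hQ : ∀ᶠ x : ℝ in 𝓝 0, A' x = Q.eval (x : ℂ)) :
    ∃ R : ℂ[X], ∀ᶠ x : ℝ in 𝓝 0, A x = R.eval (x : ℂ) := by
  obtain ⟨B, rfl⟩ := exists_polynomial_derivative_eq Q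
  obtain ⟨r, hr, hball⟩ := Metric.eventually_nhds_iff_ball.1 hQ
  have hB (x : ℝ) : HasDerivAt (fun x : ℝ => B.eval (x : ℂ)) ((derivative B).eval (x : ℂ)) x :=
    (B.hasDerivAt (x : ℂ)).comp_ofReal
  obtain ⟨c, hc⟩ := Metric.isOpen_ball.exists_is_const_of_deriv_eq_zero
    (convex_ball (0 : ℝ) r).isPreconnected (f := fun x : ℝ => A x - B.eval (x : ℂ))
    (fun x _ => ((hA x).sub (hB x)).differentiableAt.differentiableWithinAt)
    (fun x hx => ((hA x).sub (hB x)).deriv.trans (by rw [hball x hx]; simp))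
  refine ⟨B + C c, ?_⟩
  filter_upwards [Metric.ball_mem_nhds (0 : ℝ) hr] with x hx
  simp [← hc x hx]

/-- Local form of Fréchet's theorem: a continuous function of one linear form that is near zero a
sum of continuous functions of other, non-proportional, linear forms is a polynomial near zero. -/
theorem eventually_eq_polynomial_of_eventually_eq_sum {V κ : Type*} [NormedAddCommGroup V]
    [NormedSpace ℝ V] [DecidableEq κ] {h : V →L[ℝ] ℝ} (hh : ∃ v, h v = 1) {ℓ : κ → V →L[ℝ] ℝ}
    (s : Finset κ) (hs : ∀ k ∈ s, ∃ v, ℓ k v = 0 ∧ h v = 1) {ψ : ℝ → ℂ} {F : κ → ℝ → ℂ}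
    (hψ : Continuous ψ) (hF : ∀ k, Continuous (F k))
    (heq : ∀ᶠ w in 𝓝 0, ψ (h w) = ∑ k ∈ s, F k (ℓ k w)) :
    ∃ Q : ℂ[X], ∀ᶠ x : ℝ in 𝓝 0, ψ x = Q.eval (x : ℂ) := by
  induction s using Finset.induction_on generalizing ψ F with
  | empty =>
    obtain ⟨v, hv⟩ := hh
    refine ⟨0, ?_⟩
    have ht : Tendsto (fun x : ℝ => x • v) (𝓝 0) (𝓝 0) := by
      have : Continuous fun x : ℝ => x • v := by fun_prop
      simpa using this.tendsto 0
    filter_upwards [ht.eventually heq] with x hx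
    simpa [hv] using hx
  | insert a s has ih =>
    obtain ⟨v, hav, hv⟩ := hs a (Finset.mem_insert_self a s)
    obtain ⟨R, hR, hball⟩ := Metric.eventually_nhds_iff_ball.1 heq
    have hv1 : 0 < ‖v‖ + 1 := by positivity
    -- Small enough that `w + t • v` stays in the ball of radius `R` when `‖w‖ < R / 2` and `0 ≤ t ≤
    -- δ`.
    set δ : ℝ := R / (2 * (‖v‖ + 1)) with hδ
    have hδ0 : 0 < δ := by positivity
    have hδv : δ * ‖v‖ ≤ R / 2 := by
      have : δ * (‖v‖ + 1) = R / 2 := by rw [hδ]; field_simp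
      nlinarith
    -- Differencing along `v` removes the summand `a`, since `ℓ a v = 0`, and shifts the argument of
    -- `ψ` by `t`, since `h v = 1`.
    have key : ∀ w ∈ Metric.ball (0 : V) (R / 2), ∀ t ∈ Set.Icc 0 δ,
        ψ (h w + t) - ψ (h w) = ∑ k ∈ s, (F k (ℓ k w + t * ℓ k v) - F k (ℓ k w)) := by
      intro w hw t ht
      rw [mem_ball_zero_iff] at hw
      have h1 := hball w (by rw [mem_ball_zero_iff]; linarith)
      have h2 := hball (w + t • v) (by
        rw [mem_ball_zero_iff]
        calc ‖w + t • v‖ ≤ ‖w‖ + t * ‖v‖ := by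
              refine (norm_add_le _ _).trans ?_
              rw [norm_smul, Real.norm_of_nonneg ht.1]
          _ ≤ ‖w‖ + δ * ‖v‖ := by gcongr; exact ht.2
          _ < R := by linarith)
      rw [Finset.sum_insert has] at h1 h2
      simp only [map_add, map_smul, smul_eq_mul, hav, hv, mul_zero, add_zero, mul_one] at h2
      rw [h1, h2, Finset.sum_sub_distrib]
      ring
    have hs' : ∀ k ∈ s, ∃ v, ℓ k v = 0 ∧ h v = 1 := fun k hk => hs k (Finset.mem_insert_of_mem hk)
    have hnhds : Metric.ball (0 : V) (R / 2) ∈ 𝓝 0 := Metric.ball_mem_nhds _ (by positivity)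
    -- The induction hypothesis is used twice: for the difference with step `δ` and for its integral
    -- over all steps in `[0, δ]`. The first is the derivative of the moving integral `A`, the
    -- second equals `A - δ ψ`. So `A`, and with it `ψ`, is a polynomial near zero, although `ψ` is
    -- only assumed continuous.
    obtain ⟨Q₁, hQ₁⟩ := ih hs' (ψ := fun x => ψ (x + δ) - ψ x)
      (F := fun k y => F k (y + δ * ℓ k v) - F k y) (by fun_prop) (by fun_prop) (by
        filter_upwards [hnhds] with w hw using key w hw δ ⟨hδ0.le, le_rfl⟩)
    obtain ⟨Q₂, hQ₂⟩ := ih hs' (ψ := fun x => ∫ t in 0..δ, (ψ (x + t) - ψ x))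
      (F := fun k y => ∫ t in 0..δ, (F k (y + t * ℓ k v) - F k y))
      (intervalIntegral.continuous_parametric_intervalIntegral_of_continuous' (by fun_prop) _ _)
      (fun k => intervalIntegral.continuous_parametric_intervalIntegral_of_continuous'
        (by have := hF k; fun_prop) _ _) (by
        filter_upwards [hnhds] with w hw
        rw [← intervalIntegral.integral_finsetSum]
        · refine intervalIntegral.integral_congr fun t ht => ?_
          rw [Set.uIcc_of_le hδ0.le] at ht
          exact key w hw t ht
        · intro k _
          have := hF k
          exact Continuous.intervalIntegrable (by fun_prop) _ _)
    set A : ℝ → ℂ := fun x => ∫ t in x..(x + δ), ψ t with hA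
    have hAd (x : ℝ) : HasDerivAt A (ψ (x + δ) - ψ x) x := by
      have h0 (x : ℝ) : HasDerivAt (fun x => ∫ t in (0 : ℝ)..x, ψ t) (ψ x) x :=
        (hψ.integral_hasStrictDerivAt 0 x).hasDerivAt
      have := ((h0 (x + δ)).comp_add_const x δ).sub (h0 x)
      refine this.congr_of_eventuallyEq (Eventually.of_forall fun y => ?_)
      exact (intervalIntegral.integral_interval_sub_left (hψ.intervalIntegrable _ _)
        (hψ.intervalIntegrable _ _)).symm
    obtain ⟨B, hB⟩ := eventually_eq_polynomial_of_hasDerivAt hAd hQ₁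
    refine ⟨C (δ : ℂ)⁻¹ * (B - Q₂), ?_⟩
    filter_upwards [hB, hQ₂] with x hx₁ hx₂
    have hsub : ∫ t in 0..δ, (ψ (x + t) - ψ x) = A x - δ * ψ x := by
      rw [intervalIntegral.integral_sub (Continuous.intervalIntegrable (by fun_prop) _ _)
        (Continuous.intervalIntegrable (by fun_prop) _ _),
        intervalIntegral.integral_comp_add_left (fun t => ψ t) x]
      simp [hA]
    have hδ' : (δ : ℂ) ≠ 0 := by exact_mod_cast hδ0.ne'
    rw [hsub] at hx₂
    rw [eval_mul, eval_sub, eval_C, ← hx₁, ← hx₂]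
    field_simp
    ring

end BSS

/-! ### Moments from an entire extension of the characteristic function. -/

namespace BSS

open Filter Topology Polynomial

lemma differentiable_iteratedDeriv {E : ℂ → ℂ} (hE : Differentiable ℂ E) (n : ℕ) :
    Differentiable ℂ (iteratedDeriv n E) := by
  exact (hE.contDiff (n := (n + 1 : ℕ))).differentiable_iteratedDeriv n (by exact_mod_cast n.lt_succ_self)

lemma iteratedDeriv_comp_ofReal {E : ℂ → ℂ} (hE : Differentiable ℂ E) (n : ℕ) :
    iteratedDeriv n (fun t : ℝ => E t) = fun t : ℝ => iteratedDeriv n E t := by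
  induction n with
  | zero => simp
  | succ n ih =>
    ext t
    rw [iteratedDeriv_succ, iteratedDeriv_succ, ih]
    exact ((differentiable_iteratedDeriv hE n).differentiableAt.hasDerivAt).comp_ofReal.deriv

lemma exists_norm_second_difference_le {E : ℂ → ℂ} (hE : Differentiable ℂ E) :
    ∃ C, ∀ᶠ z in 𝓝 (0 : ℂ), ‖E z + E (-z) - 2 * E 0‖ ≤ C * ‖z‖ ^ 2 := by
  have hd {f : ℂ → ℂ} (hf : Differentiable ℂ f) : Differentiable ℂ (dslope f 0) := by
    rw [← differentiableOn_univ] at hf ⊢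
    exact (Complex.differentiableOn_dslope univ_mem).2 hf
  set D := dslope E 0
  have hD : Differentiable ℂ D := hd hE
  have hD₂ : Differentiable ℂ (dslope D 0) := hd hD
  -- Second-order expansion by two divided slopes; the linear term cancels in the symmetric
  -- difference.
  have h1 (z : ℂ) : E z = E 0 + z * (D 0 + z * dslope D 0 z) := by
    have e1 := sub_smul_dslope E 0 z
    have e2 := sub_smul_dslope D 0 z
    simp only [sub_zero, smul_eq_mul] at e1 e2
    rw [e2]
    change z * D z = _ at e1
    linear_combination -e1
  have hcont : Continuous fun z => ‖dslope D 0 z + dslope D 0 (-z)‖ :=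
    (hD₂.continuous.add (hD₂.continuous.comp continuous_neg)).norm
  refine ⟨‖dslope D 0 0 + dslope D 0 (-0)‖ + 1, ?_⟩
  filter_upwards [(hcont.tendsto 0).eventually_le_const (lt_add_one _)] with z hz
  rw [h1 z, h1 (-z)]
  have : E 0 + z * (D 0 + z * dslope D 0 z) + (E 0 + -z * (D 0 + -z * dslope D 0 (-z))) - 2 * E 0
      = (dslope D 0 z + dslope D 0 (-z)) * z ^ 2 := by ring
  rw [this, norm_mul, norm_pow]
  gcongr

/-- A finite measure whose characteristic function agrees near zero with an entire function has a
finite second moment. -/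
lemma integrable_sq_of_charFun_eventually_eq {ν : Measure ℝ} [IsFiniteMeasure ν] {E : ℂ → ℂ}
    (hE : Differentiable ℂ E) (h : ∀ᶠ t : ℝ in 𝓝 0, charFun ν t = E t) :
    Integrable (fun x => x ^ 2) ν := by
  obtain ⟨C, hC⟩ := exists_norm_second_difference_le hE
  have hC' : ∀ᶠ t : ℝ in 𝓝 0, ‖E t + E (-t) - 2 * E 0‖ ≤ C * t ^ 2 := by
    have : Tendsto (fun t : ℝ => (t : ℂ)) (𝓝 0) (𝓝 0) := by
      simpa using Complex.continuous_ofReal.tendsto 0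
    filter_upwards [this.eventually hC] with t ht
    simpa using ht
  have hneg : ∀ᶠ t : ℝ in 𝓝 0, charFun ν (-t) = E (-t) := by
    have : Tendsto (fun t : ℝ => -t) (𝓝 0) (𝓝 0) := by simpa using continuous_neg.tendsto (0 : ℝ)
    filter_upwards [this.eventually h] with t ht
    simpa using ht
  have hint (t : ℝ) : Integrable (fun x : ℝ => Complex.exp (t * x * Complex.I)) ν := by
    refine (integrable_const (1 : ℝ)).mono' (by fun_prop) (ae_of_all _ fun x => ?_)
    rw [← Complex.ofReal_mul, Complex.norm_exp_ofReal_mul_I]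
  have hcos (t : ℝ) : Integrable (fun x => 2 - 2 * Real.cos (t * x)) ν := by
    refine (integrable_const (4 : ℝ)).mono' (by fun_prop) (ae_of_all _ fun x => ?_)
    rw [Real.norm_eq_abs, abs_le]
    constructor <;> linarith [Real.cos_le_one (t * x), Real.neg_one_le_cos (t * x)]
  -- The symmetric second difference of the characteristic function at zero is minus this integral.
  have hval : ∀ᶠ t : ℝ in 𝓝 0, ∫ x, (2 - 2 * Real.cos (t * x)) ∂ν ≤ C * t ^ 2 := by
    filter_upwards [h, hneg, hC'] with t ht1 ht2 ht3
    have h0 := h.self_of_nhds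
    have hadd : Integrable (fun x : ℝ => Complex.exp (t * x * Complex.I)
        + Complex.exp ((-t : ℝ) * x * Complex.I)) ν := (hint t).add (hint (-t))
    have : ((∫ x, (2 - 2 * Real.cos (t * x)) ∂ν : ℝ) : ℂ) = -(E t + E (-t) - 2 * E 0) := by
      simp only [Complex.ofReal_zero] at h0
      rw [← ht1, ← ht2, ← h0, ← integral_complex_ofReal, charFun_apply_real, charFun_apply_real,
        charFun_apply_real, ← integral_add (hint t) (hint (-t)), ← integral_const_mul,
        ← integral_sub hadd ((hint 0).const_mul 2), ← integral_neg]
      refine integral_congr_ae (ae_of_all _ fun x => ?_)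
      have := Complex.two_cos (t * x : ℂ)
      simp only [Complex.ofReal_sub, Complex.ofReal_mul, Complex.ofReal_cos, Complex.ofReal_neg,
        Complex.ofReal_ofNat, this]
      simp [neg_mul]
    calc _ ≤ ‖((∫ x, (2 - 2 * Real.cos (t * x)) ∂ν : ℝ) : ℂ)‖ := by
          rw [Complex.norm_real]; exact le_abs_self _
      _ ≤ _ := by rw [this, norm_neg]; exact ht3
  have hlim : Tendsto (fun n : ℕ => 1 / ((n : ℝ) + 1)) atTop (𝓝 0) :=
    tendsto_one_div_add_atTop_nhds_zero_nat
  have hbound : ∀ᶠ n : ℕ in atTop, ∫⁻ x, ENNReal.ofReal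
      (((n : ℝ) + 1) ^ 2 * (2 - 2 * Real.cos (1 / ((n : ℝ) + 1) * x))) ∂ν ≤ ENNReal.ofReal C := by
    filter_upwards [hlim.eventually hval] with n hn
    rw [← ofReal_integral_eq_lintegral_ofReal ((hcos _).const_mul _)
      (ae_of_all _ fun x => mul_nonneg (by positivity) (by linarith [Real.cos_le_one (1 / ((n : ℝ) + 1) * x)])), integral_const_mul]
    refine ENNReal.ofReal_le_ofReal ?_
    have hn0 : (0 : ℝ) < (n : ℝ) + 1 := by positivity
    calc _ ≤ ((n : ℝ) + 1) ^ 2 * (C * (1 / ((n : ℝ) + 1)) ^ 2) := by gcongr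
      _ = C := by field_simp
  -- The bound `cos y ≤ 1 - 2 / π² * y²` for `|y| ≤ π` applies once `n` is large for the given `x`;
  -- Fatou's lemma then bounds the second moment.
  have hpt (x : ℝ) : ENNReal.ofReal (4 / Real.pi ^ 2 * x ^ 2) ≤ liminf (fun n : ℕ =>
      ENNReal.ofReal (((n : ℝ) + 1) ^ 2 * (2 - 2 * Real.cos (1 / ((n : ℝ) + 1) * x)))) atTop := by
    have : Tendsto (fun n : ℕ => |1 / ((n : ℝ) + 1) * x|) atTop (𝓝 0) := by
      simpa using (hlim.mul_const x).abs
    refine le_liminf_of_le (by isBoundedDefault) ?_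
    filter_upwards [this.eventually_le_const Real.pi_pos] with n hn
    refine ENNReal.ofReal_le_ofReal ?_
    have hn0 : (0 : ℝ) < (n : ℝ) + 1 := by positivity
    have hc := Real.cos_le_one_sub_mul_cos_sq hn
    calc 4 / Real.pi ^ 2 * x ^ 2
        = ((n : ℝ) + 1) ^ 2 * (2 * (2 / Real.pi ^ 2 * (1 / ((n : ℝ) + 1) * x) ^ 2)) := by
          field_simp; ring
      _ ≤ _ := by gcongr; linarith
  have hfin : ∫⁻ x, ENNReal.ofReal (4 / Real.pi ^ 2 * x ^ 2) ∂ν < ⊤ := by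
    calc _ ≤ _ := lintegral_mono hpt
      _ ≤ _ := lintegral_liminf_le fun n => by fun_prop
      _ ≤ ENNReal.ofReal C := liminf_le_of_frequently_le' hbound.frequently
      _ < ⊤ := ENNReal.ofReal_lt_top
  have hI : Integrable (fun x => 4 / Real.pi ^ 2 * x ^ 2) ν := by
    refine ⟨by fun_prop, ?_⟩
    rwa [hasFiniteIntegral_iff_ofReal (ae_of_all _ fun x => by positivity)]
  convert! hI.const_mul (Real.pi ^ 2 / 4) using 2
  field_simp

/-- Induction through reweighting: once the moment of order `2k` is finite, `x ^ (2k) μ` is a finite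
measure whose characteristic function is `(-1) ^ k` times the `2k`-th derivative of that of `μ`. It
again agrees near zero with an entire function, so the second-moment case gains two more orders. -/
lemma memLp_id_of_charFun_eventually_eq {μ : Measure ℝ} [IsFiniteMeasure μ] {E : ℂ → ℂ}
    (hE : Differentiable ℂ E) (h : ∀ᶠ t : ℝ in 𝓝 0, charFun μ t = E t) (k : ℕ) :
    MemLp id (2 * k : ℕ) μ := by
  have hiff (k : ℕ) : MemLp id ((2 * k : ℕ) : ENNReal) μ ↔ Integrable (fun x => x ^ (2 * k)) μ := by
    rcases Nat.eq_zero_or_pos k with rfl | hk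
    · simp [memLp_zero_iff_aestronglyMeasurable, aestronglyMeasurable_id]
    · rw [← integrable_norm_rpow_iff aestronglyMeasurable_id (by simpa using hk.ne')
        (ENNReal.natCast_ne_top _)]
      refine integrable_congr (ae_of_all _ fun x => ?_)
      simp only [id, ENNReal.toReal_natCast, Real.rpow_natCast, Real.norm_eq_abs]
      rw [pow_mul, pow_mul, sq_abs]
  induction k with
  | zero => rw [hiff]; simp
  | succ k ih =>
    have hI := (hiff k).1 ih
    set w : ℝ → ENNReal := fun x => ENNReal.ofReal (x ^ (2 * k)) with hw
    have hpos (x : ℝ) : 0 ≤ x ^ (2 * k) := by rw [pow_mul]; positivity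
    have : IsFiniteMeasure (μ.withDensity w) := isFiniteMeasure_withDensity_ofReal hI.2
    have hwm : Measurable w := by fun_prop
    have hchar (t : ℝ) : charFun (μ.withDensity w) t
        = (-1) ^ k * iteratedDeriv (2 * k) (charFun μ) t := by
      rw [iteratedDeriv_charFun ih, pow_mul, Complex.I_sq, ← mul_assoc, ← mul_pow, charFun_apply_real,
        integral_withDensity_eq_integral_toReal_smul hwm (ae_of_all _ fun x => ENNReal.ofReal_lt_top)]
      norm_num
      refine integral_congr_ae (ae_of_all _ fun x => ?_)
      simp [hw, ENNReal.toReal_ofReal (hpos x)]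
    have hsq := integrable_sq_of_charFun_eventually_eq (ν := μ.withDensity w)
      ((differentiable_iteratedDeriv hE (2 * k)).const_mul ((-1) ^ k)) (by
        have h' := EventuallyEq.iteratedDeriv (n := 2 * k)
          (show charFun μ =ᶠ[𝓝 0] fun t : ℝ => E t from h)
        rw [iteratedDeriv_comp_ofReal hE] at h'
        filter_upwards [h'] with t ht
        rw [hchar, ht])
    rw [hiff]
    rw [integrable_withDensity_iff hwm (ae_of_all _ fun x => ENNReal.ofReal_lt_top)] at hsq
    refine hsq.congr (ae_of_all _ fun x => ?_)
    simp only [hw, ENNReal.toReal_ofReal (hpos x)]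
    ring

/-- A finite measure whose characteristic function agrees near zero with an entire function has
exponential moments of all orders. -/
lemma integrable_exp_mul_of_charFun_eventually_eq {μ : Measure ℝ} [IsFiniteMeasure μ] {E : ℂ → ℂ}
    (hE : Differentiable ℂ E) (h : ∀ᶠ t : ℝ in 𝓝 0, charFun μ t = E t) (r : ℝ) :
    Integrable (fun x => Real.exp (r * x)) μ := by
  have hmem := memLp_id_of_charFun_eventually_eq hE h
  have hI (k : ℕ) : Integrable (fun x => x ^ (2 * k)) μ := by
    have := (hmem k).integrable_norm_pow'
    refine this.congr (ae_of_all _ fun x => ?_)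
    simp only [id, Real.norm_eq_abs]
    rw [pow_mul, pow_mul, sq_abs]
  have hmom (k : ℕ) : ‖iteratedDeriv (2 * k) E 0‖ = ∫ x, x ^ (2 * k) ∂μ := by
    have h1 := EventuallyEq.iteratedDeriv_eq (n := 2 * k)
      (show charFun μ =ᶠ[𝓝 0] fun t : ℝ => E t from h)
    rw [iteratedDeriv_comp_ofReal hE, iteratedDeriv_charFun_zero (hmem k)] at h1
    simp only [Complex.ofReal_zero] at h1
    rw [← h1, norm_mul, norm_pow, Complex.norm_I, one_pow, one_mul]
    rw [Complex.norm_real, Real.norm_of_nonneg]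
    exact integral_nonneg fun x => by rw [pow_mul]; positivity
  -- The even moments are, up to sign, derivatives of `E` at zero, and the Taylor series of an
  -- entire function converges absolutely at `r`. The sum is the integral of `cosh (r x)`, whose
  -- terms are nonnegative, so no convergence is needed to exchange sum and integral.
  have hsum : Summable fun k : ℕ => (r ^ (2 * k) / (2 * k).factorial) * ∫ x, x ^ (2 * k) ∂μ := by
    have := (Complex.hasSum_taylorSeries_of_entire hE 0 r).summable.norm.comp_injective
      (i := fun k : ℕ => 2 * k) (fun a b hab => by simpa using hab)
    refine this.congr fun k => ?_
    simp only [Function.comp, norm_smul, sub_zero, norm_inv, norm_pow, hmom, Complex.norm_real,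
      Complex.norm_natCast, Real.norm_eq_abs]
    rw [pow_mul |r|, sq_abs, ← pow_mul]
    ring
  have hcosh : ∫⁻ x, ENNReal.ofReal (Real.cosh (r * x)) ∂μ < ⊤ := by
    have hnn (k : ℕ) (x : ℝ) : 0 ≤ (r * x) ^ (2 * k) / ((2 * k).factorial : ℝ) := by
      rw [pow_mul]; positivity
    have : ∀ x, ENNReal.ofReal (Real.cosh (r * x))
        = ∑' k : ℕ, ENNReal.ofReal ((r * x) ^ (2 * k) / (2 * k).factorial) := fun x => by
      rw [← (Real.hasSum_cosh (r * x)).tsum_eq,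
        ENNReal.ofReal_tsum_of_nonneg (fun k => hnn k x) (Real.hasSum_cosh (r * x)).summable]
    simp_rw [this]
    rw [lintegral_tsum fun k => by fun_prop]
    have h2 (k : ℕ) : ∫⁻ x, ENNReal.ofReal ((r * x) ^ (2 * k) / (2 * k).factorial) ∂μ
        = ENNReal.ofReal ((r ^ (2 * k) / (2 * k).factorial) * ∫ x, x ^ (2 * k) ∂μ) := by
      have e : (fun x : ℝ => (r * x) ^ (2 * k) / ((2 * k).factorial : ℝ))
          = fun x => (r ^ (2 * k) / (2 * k).factorial) * x ^ (2 * k) := by ext x; ring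
      rw [← ofReal_integral_eq_lintegral_ofReal (by rw [e]; exact (hI k).const_mul _)
        (ae_of_all _ (hnn k)), e, integral_const_mul]
    simp_rw [h2]
    exact hsum.tsum_ofReal_lt_top
  refine Integrable.mono' (g := fun x => 2 * Real.cosh (r * x)) (Integrable.const_mul ?_ 2)
    (by fun_prop) (ae_of_all _ fun x => ?_)
  · refine ⟨by fun_prop, ?_⟩
    rwa [hasFiniteIntegral_iff_ofReal (ae_of_all _ fun x => (Real.cosh_pos _).le)]
  · rw [Real.norm_eq_abs, Real.abs_exp, Real.cosh_eq]
    linarith [Real.exp_pos (-(r * x))]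

end BSS

/-! ### Marcinkiewicz's theorem. -/

namespace BSS

open Filter Topology Polynomial

lemma tendsto_eval_mul_div_pow_natDegree (R : ℂ[X]) (u : ℂ) :
    Tendsto (fun r : ℝ => R.eval ((r : ℂ) * u) / (r : ℂ) ^ R.natDegree) atTop
      (𝓝 (R.leadingCoeff * u ^ R.natDegree)) := by
  have h (i : ℕ) (hi : i ∈ Finset.range (R.natDegree + 1)) :
      Tendsto (fun r : ℝ => R.coeff i * u ^ i * ((r : ℂ) ^ i / (r : ℂ) ^ R.natDegree)) atTop
        (𝓝 (if i = R.natDegree then R.coeff i * u ^ i else 0)) := by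
    split_ifs with hn
    · subst hn
      refine tendsto_const_nhds.congr' ?_
      filter_upwards [eventually_ne_atTop 0] with r hr
      rw [div_self (pow_ne_zero _ (by exact_mod_cast hr)), mul_one]
    · have hlt : i < R.natDegree := lt_of_le_of_ne (Nat.lt_succ_iff.1 (Finset.mem_range.1 hi)) hn
      have h1 := ((Complex.continuous_ofReal.tendsto 0).comp
        (tendsto_pow_div_pow_atTop_zero (𝕜 := ℝ) hlt)).const_mul (R.coeff i * u ^ i)
      simpa using h1
  have hsum := tendsto_finsetSum _ h
  rw [Finset.sum_ite_eq' _ R.natDegree, if_pos (Finset.self_mem_range_succ _)] at hsum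
  refine hsum.congr fun r => ?_
  rw [eval_eq_sum_range, Finset.sum_div]
  refine Finset.sum_congr rfl fun i _ => ?_
  rw [mul_pow]
  ring

/-- A polynomial whose real part is largest on the real axis, along every vertical line, is at most
quadratic. -/
lemma natDegree_le_two_of_re_eval_le {R : ℂ[X]}
    (hR : ∀ z : ℂ, (R.eval z).re ≤ (R.eval (z.re : ℂ)).re) : R.natDegree ≤ 2 := by
  by_contra! hm
  set m := R.natDegree
  set c := R.leadingCoeff with hc
  -- The hypothesis at `r u`, divided by `r ^ m` as `r → ∞`, passes to the leading monomial.
  have hlead (u : ℂ) : (c * u ^ m).re ≤ (c * (u.re : ℂ) ^ m).re := by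
    have h1 := (Complex.continuous_re.tendsto _).comp (tendsto_eval_mul_div_pow_natDegree R u)
    have h2 := (Complex.continuous_re.tendsto _).comp
      (tendsto_eval_mul_div_pow_natDegree R (u.re : ℂ))
    refine le_of_tendsto_of_tendsto h1 h2 ?_
    filter_upwards [eventually_gt_atTop 0] with r hr
    have := hR (r * u)
    simp only [Function.comp, ← Complex.ofReal_pow, Complex.div_ofReal_re]
    simp only [Complex.mul_re, Complex.ofReal_re, Complex.ofReal_im, zero_mul, sub_zero] at this
    rw [← Complex.ofReal_mul]
    gcongr
  have htrig (θ : ℝ) : c.re * Real.cos (m * θ) - c.im * Real.sin (m * θ)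
      ≤ c.re * Real.cos θ ^ m := by
    have := hlead (Complex.exp (θ * Complex.I))
    rw [← Complex.exp_nat_mul, ← mul_assoc, ← Complex.ofReal_natCast, ← Complex.ofReal_mul,
      Complex.exp_ofReal_mul_I_re, ← Complex.ofReal_pow] at this
    simpa [Complex.mul_re, Complex.exp_ofReal_mul_I_re, Complex.exp_ofReal_mul_I_im,
      -Complex.ofReal_pow, -Complex.ofReal_mul] using this
  have hcos (θ : ℝ) : c.re * Real.cos (m * θ) ≤ c.re * Real.cos θ ^ m := by
    have h1 := htrig θ
    have h2 := htrig (-θ)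
    simp only [mul_neg, Real.cos_neg, Real.sin_neg] at h2
    linarith
  have hm0 : (0 : ℝ) < m := by positivity
  have hm3 : (3 : ℝ) ≤ m := by exact_mod_cast hm
  -- At `θ = 2π/m` the left side is `c.re`, while `|cos θ| < 1` because `m ≥ 3`; this excludes `c.re
  -- > 0`. At `θ = π/m` the left side is `-c.re`, while `cos θ > 0`; this excludes `c.re < 0`.
  have hre : c.re = 0 := by
    apply le_antisymm
    · by_contra! hpos
      have h1 := hcos (2 * Real.pi / m)
      rw [mul_div_cancel₀ _ hm0.ne', Real.cos_two_pi] at h1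
      have h2 : |Real.cos (2 * Real.pi / m)| < 1 := by
        rw [← sq_lt_one_iff_abs_lt_one]
        have : 0 < Real.sin (2 * Real.pi / m) := by
          apply Real.sin_pos_of_pos_of_lt_pi (by positivity)
          rw [div_lt_iff₀ hm0]
          nlinarith [Real.pi_pos]
        nlinarith [Real.sin_sq_add_cos_sq (2 * Real.pi / m)]
      have h3 : Real.cos (2 * Real.pi / m) ^ m < 1 := by
        refine (le_abs_self _).trans_lt ?_
        rw [abs_pow]
        exact pow_lt_one₀ (abs_nonneg _) h2 (by lia)
      nlinarith
    · by_contra! hneg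
      have h1 := hcos (Real.pi / m)
      rw [mul_div_cancel₀ _ hm0.ne', Real.cos_pi] at h1
      have h2 : 0 < Real.cos (Real.pi / m) := by
        apply Real.cos_pos_of_mem_Ioo ⟨?_, ?_⟩
        · have : 0 < Real.pi / m := by positivity
          linarith [Real.pi_pos]
        · rw [div_lt_div_iff₀ hm0 two_pos]
          nlinarith [Real.pi_pos]
      nlinarith [pow_pos h2 m]
  have him : c.im = 0 := by
    have h1 := htrig (Real.pi / 2 / m)
    have h2 := htrig (-(Real.pi / 2 / m))
    simp only [hre, zero_mul, mul_neg, Real.sin_neg, mul_div_cancel₀ _ hm0.ne',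
      Real.sin_pi_div_two] at h1 h2
    linarith
  have : c ≠ 0 := by
    rw [hc, leadingCoeff_ne_zero]
    rintro rfl
    simp [m] at hm
  exact this (Complex.ext hre him)

/-- **Marcinkiewicz's theorem**, local form: a probability measure whose characteristic function
is near zero the exponential of a polynomial is Gaussian. -/
theorem exists_eq_gaussianReal_of_charFun_eventually_eq {μ : Measure ℝ} [IsProbabilityMeasure μ]
    {Q : ℂ[X]} (h : ∀ᶠ t : ℝ in 𝓝 0, charFun μ t = Complex.exp (Q.eval (t : ℂ))) :
    ∃ m v, μ = gaussianReal m v := by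
  have hE : Differentiable ℂ fun z => Complex.exp (Q.eval z) := by fun_prop
  have hset : integrableExpSet id μ = Set.univ :=
    Set.eq_univ_of_forall fun r => integrable_exp_mul_of_charFun_eventually_eq hE h r
  have hint (z : ℂ) : z.re ∈ interior (integrableExpSet id μ) := by simp [hset]
  -- The characteristic function at `t` is the complex moment generating function at `it`, hence the
  -- substitution `z ↦ -iz`; the identity theorem then extends the equality from the imaginary axis
  -- near zero to the plane.
  set R : ℂ[X] := Q.comp (C (-Complex.I) * X) with hRdef
  have hM : complexMGF id μ = fun z => Complex.exp (R.eval z) := by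
    have hE' : Differentiable ℂ fun z => Complex.exp (R.eval z) := by fun_prop
    refine AnalyticOnNhd.eq_of_frequently_eq (z₀ := 0)
      (fun z _ => analyticAt_complexMGF (hint z)) (fun z _ => hE'.analyticAt z) ?_
    have ht : Tendsto (fun t : ℝ => (t : ℂ) * Complex.I) (𝓝[≠] 0) (𝓝[≠] 0) := by
      refine tendsto_nhdsWithin_of_tendsto_nhds_of_eventually_within _ ?_ ?_
      · have : Continuous fun t : ℝ => (t : ℂ) * Complex.I := by fun_prop
        simpa using (this.tendsto 0).mono_left nhdsWithin_le_nhds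
      · filter_upwards [self_mem_nhdsWithin] with t ht
        simpa using ht
    refine ht.frequently (Eventually.frequently ?_)
    filter_upwards [nhdsWithin_le_nhds h] with t ht
    rw [complexMGF_id_mul_I, ht, hRdef, eval_comp]
    congr 2
    simp only [eval_mul, eval_C, eval_X]
    linear_combination (t : ℂ) * Complex.I_mul_I
  -- `|E exp (zX)| ≤ E exp (Re z X)` is the ridge property required of `R`.
  have hdeg : R.natDegree ≤ 2 := by
    refine natDegree_le_two_of_re_eval_le fun z => ?_
    have h1 : ‖complexMGF id μ z‖ ≤ ‖complexMGF id μ (z.re : ℂ)‖ := by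
      rw [complexMGF_ofReal, Complex.norm_real, Real.norm_of_nonneg mgf_nonneg]
      exact norm_complexMGF_le_mgf
    simpa [hM, Complex.norm_exp] using h1
  set a := R.coeff 0
  set b := R.coeff 1
  set c := R.coeff 2
  have hR (z : ℂ) : R.eval z = a + b * z + c * z ^ 2 := by
    rw [eval_eq_sum_range' (Nat.lt_succ_of_le hdeg)]
    simp [Finset.sum_range_succ, a, b, c]
  have ha : Complex.exp a = 1 := by
    have h0 := congrFun hM 0
    simpa [hR, complexMGF] using h0.symm
  have hM' : complexMGF id μ = fun z => Complex.exp (b * z + c * z ^ 2) := by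
    rw [hM]
    ext z
    rw [hR, add_assoc, Complex.exp_add, ha, one_mul]
  have hexp (z : ℂ) : HasDerivAt (fun z => Complex.exp (b * z + c * z ^ 2))
      (Complex.exp (b * z + c * z ^ 2) * (b + 2 * c * z)) z := by
    have h1 := ((hasDerivAt_id z).const_mul b).add ((hasDerivAt_pow 2 z).const_mul c)
    refine h1.cexp.congr_deriv ?_
    simp
    ring
  have hd (z : ℂ) : ∫ x : ℝ, (x : ℂ) * Complex.exp (z * x) ∂μ
      = Complex.exp (b * z + c * z ^ 2) * (b + 2 * c * z) := by
    have h1 := hasDerivAt_complexMGF (hint z)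
    rw [hM'] at h1
    exact h1.unique (hexp z)
  -- The first two derivatives at zero identify `b` with the mean and `2c` with the variance, so the
  -- exponent is that of a real Gaussian.
  have hb : b = ((∫ x, x ∂μ : ℝ) : ℂ) := by
    have h1 := hd 0
    simp only [zero_mul, Complex.exp_zero, mul_one, mul_zero, ne_eq, OfNat.ofNat_ne_zero,
      not_false_eq_true, zero_pow, add_zero, one_mul] at h1
    rw [← h1, integral_complex_ofReal]
  have hc : b ^ 2 + 2 * c = ((∫ x, x ^ 2 ∂μ : ℝ) : ℂ) := by
    have h1 := hasDerivAt_integral_pow_mul_exp (hint 0) 1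
    have e : (fun z : ℂ => ∫ x : ℝ, ((id x : ℝ) : ℂ) ^ 1 * Complex.exp (z * (id x : ℝ)) ∂μ)
        = fun z => Complex.exp (b * z + c * z ^ 2) * (b + 2 * c * z) := by
      ext z
      simpa using hd z
    rw [e] at h1
    have h2 := (hexp 0).mul (((hasDerivAt_id (0 : ℂ)).const_mul (2 * c)).const_add b)
    have h3 := h2.unique h1
    simp only [id] at h3
    rw [← integral_complex_ofReal]
    simp at h3
    simp only [Complex.ofReal_pow]
    rw [← h3]
    ring
  have hmem : MemLp id 2 μ := memLp_id_of_charFun_eventually_eq hE h 1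
  have hvar : Var[id; μ] = (∫ x, x ^ 2 ∂μ) - (∫ x, x ∂μ) ^ 2 := by
    rw [variance_eq_sub hmem]
    simp
  refine ⟨∫ x, x ∂μ, Var[id; μ].toNNReal, Measure.ext_of_complexMGF_id_eq ?_⟩
  ext z
  rw [hM', complexMGF_id_gaussianReal, Real.coe_toNNReal _ (variance_nonneg _ _), hvar]
  push_cast
  rw [← hc, ← hb]
  congr 1
  ring

end BSS

/-! ### Darmois' theorem and identifiability of the filter. -/

namespace BSS

open Filter Topology Polynomial

/-- Near zero `φ` stays in the slit plane. Clamping the argument to a small interval makes the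
logarithm continuous on all of `ℝ`, as the Fréchet argument requires. -/
lemma exists_continuous_eventually_exp_eq {φ : ℝ → ℂ} (hφ : Continuous φ) (h0 : φ 0 = 1) :
    ∃ ψ : ℝ → ℂ, Continuous ψ ∧ ψ 0 = 0 ∧ ∀ᶠ x in 𝓝 0, Complex.exp (ψ x) = φ x := by
  have hopen : φ ⁻¹' Complex.slitPlane ∈ 𝓝 0 :=
    (Complex.isOpen_slitPlane.preimage hφ).mem_nhds (by simp [h0])
  obtain ⟨r, hr, hball⟩ := Metric.nhds_basis_closedBall.mem_iff.1 hopen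
  rw [Real.closedBall_eq_Icc, zero_sub, zero_add] at hball
  have hle : -r ≤ r := by linarith
  have hmem (x : ℝ) : φ (Set.projIcc (-r) r hle x) ∈ Complex.slitPlane :=
    hball (Set.projIcc (-r) r hle x).2
  refine ⟨fun x => Complex.log (φ (Set.projIcc (-r) r hle x)), ?_, ?_, ?_⟩
  · exact (hφ.comp (continuous_subtype_val.comp continuous_projIcc)).clog hmem
  · beta_reduce
    rw [Set.projIcc_of_mem hle (x := 0) ⟨by linarith, hr.le⟩]
    simp [h0]
  · filter_upwards [Icc_mem_nhds (show -r < 0 by linarith) hr] with x hx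
    rw [Complex.exp_log (Complex.slitPlane_ne_zero (hmem x)), Set.projIcc_of_mem hle hx]

/-- Removes the `2πi` ambiguity when an identity of characteristic functions is turned into one of
logarithms. -/
lemma eventually_eq_zero_of_exp_eq_one {V : Type*} [TopologicalSpace V] {x₀ : V} {D : V → ℂ}
    (hD : ContinuousAt D x₀) (h0 : D x₀ = 0) (h : ∀ᶠ w in 𝓝 x₀, Complex.exp (D w) = 1) :
    ∀ᶠ w in 𝓝 x₀, D w = 0 := by
  have hn : ∀ᶠ w in 𝓝 x₀, ‖D w‖ < 2 * Real.pi := by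
    have := hD.norm.tendsto
    rw [h0, norm_zero] at this
    exact this.eventually_lt_const Real.two_pi_pos
  filter_upwards [h, hn] with w hw hlt
  obtain ⟨n, hn⟩ := Complex.exp_eq_one_iff.1 hw
  rw [hn] at hlt
  simp only [Complex.norm_mul, Complex.norm_intCast, Complex.norm_I, mul_one, Complex.norm_real,
    Real.norm_of_nonneg Real.pi_pos.le, Complex.norm_ofNat] at hlt
  have hn1 : |(n : ℝ)| < 1 := by
    by_contra! hle
    nlinarith [Real.two_pi_pos]
  have : n = 0 := by
    rw [← Int.cast_abs] at hn1
    exact Int.abs_lt_one_iff.1 (by exact_mod_cast hn1)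
  rw [hn, this]
  simp

section Darmois

variable {Ω ι : Type*} [MeasurableSpace Ω] {P : Measure Ω}
  [Fintype ι] {A : Matrix ι ι ℝ} {X : ι → Ω → ℝ}

lemma charFun_map_sum_mul {X : ι → Ω → ℝ} (hm : ∀ i, AEMeasurable (X i) P) (hX : iIndepFun X P)
    (c : ι → ℝ) :
    charFun (P.map fun ω => ∑ i, c i * X i ω) 1 = ∏ i, charFun (P.map (X i)) (c i) := by
  have hind : iIndepFun (fun i ω => c i * X i ω) P :=
    hX.comp (fun i x => c i * x) fun i => by fun_prop
  rw [hind.charFun_map_fun_sum_eq_prod fun i => (hm i).const_mul _, Finset.prod_apply]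
  simp_rw [charFun_map_mul_comp (hm _), mul_one]

/-- Both sides are the characteristic function at `1` of `∑ i, w i * Y i`, factored over the sources
and over the mixtures. -/
lemma prod_charFun_eq_prod_charFun (hm : ∀ i, AEMeasurable (X i) P) (hX : iIndepFun X P)
    (hY : iIndepFun (fun i ω => ∑ j, A i j * X j ω) P) (w : ι → ℝ) :
    ∏ j, charFun (P.map (X j)) (∑ i, w i * A i j)
      = ∏ i, charFun (P.map fun ω => ∑ j, A i j * X j ω) (w i) := by
  have hmY (i : ι) : AEMeasurable (fun ω => ∑ j, A i j * X j ω) P := by fun_prop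
  rw [← charFun_map_sum_mul hm hX, ← charFun_map_sum_mul hmY hY]
  congr 3 with ω
  simp_rw [Finset.mul_sum, Finset.sum_mul]
  rw [Finset.sum_comm]
  simp_rw [mul_assoc]

/-- **Darmois' theorem** for invertible mixtures: a source that contributes to two independent
mixtures is Gaussian. -/
theorem hasGaussianLaw_of_iIndepFun_mixture [IsProbabilityMeasure P] [DecidableEq ι] (hA : IsUnit A.det)
    (hm : ∀ i, AEMeasurable (X i) P) (hX : iIndepFun X P)
    (hY : iIndepFun (fun i ω => ∑ j, A i j * X j ω) P) {j₀ i₁ i₂ : ι} (hi : i₁ ≠ i₂)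
    (h₁ : A i₁ j₀ ≠ 0) (h₂ : A i₂ j₀ ≠ 0) : HasGaussianLaw (X j₀) P := by
  have hprob (Z : Ω → ℝ) (hZ : AEMeasurable Z P) : IsProbabilityMeasure (P.map Z) :=
    Measure.isProbabilityMeasure_map hZ
  have hmY (i : ι) : AEMeasurable (fun ω => ∑ j, A i j * X j ω) P := by fun_prop
  have hlog (Z : Ω → ℝ) (hZ : AEMeasurable Z P) := by
    have := hprob Z hZ
    exact exists_continuous_eventually_exp_eq (continuous_charFun (μ := P.map Z)) (by simp)
  choose ψ hψ hψ0 hψe using fun j => hlog (X j) (hm j)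
  choose g hg hg0 hge using fun i => hlog (fun ω => ∑ j, A i j * X j ω) (hmY i)
  let col (j : ι) : (ι → ℝ) →L[ℝ] ℝ := ∑ i, A i j • ContinuousLinearMap.proj i
  have hcol (j : ι) (w : ι → ℝ) : col j w = ∑ i, w i * A i j := by
    simp [col, mul_comm]
  have hcol_tendsto (j : ι) : Tendsto (col j) (𝓝 0) (𝓝 0) := by
    simpa using (col j).continuous.tendsto 0
  have hproj_tendsto (i : ι) : Tendsto (fun w : ι → ℝ => w i) (𝓝 0) (𝓝 0) := by
    simpa using (continuous_apply i).tendsto (0 : ι → ℝ)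
  have hzero : ∀ᶠ w : ι → ℝ in 𝓝 0, ∑ j, ψ j (col j w) - ∑ i, g i (w i) = 0 := by
    refine eventually_eq_zero_of_exp_eq_one (Continuous.continuousAt (by fun_prop)) ?_ ?_
    · simp [hψ0, hg0]
    · filter_upwards [eventually_all.2 fun j => (hcol_tendsto j).eventually (hψe j),
        eventually_all.2 fun i => (hproj_tendsto i).eventually (hge i)] with w hw₁ hw₂
      rw [Complex.exp_sub, div_eq_one_iff_eq (Complex.exp_ne_zero _), Complex.exp_sum,
        Complex.exp_sum]
      simp_rw [hw₁, hw₂, hcol]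
      exact prod_charFun_eq_prod_charFun hm hX hY w
  -- Each other form must vanish at some vector where `col j₀` is `1`. For another column, row `j₀`
  -- of `A⁻¹` works. For a coordinate `i`, a multiple of the basis vector at `i₁` or `i₂`, whichever
  -- differs from `i`, works; this is where two non-zero entries are needed.
  obtain ⟨Q, hQ⟩ := eventually_eq_polynomial_of_eventually_eq_sum (V := ι → ℝ) (h := col j₀)
    (ℓ := Sum.elim col fun i => ContinuousLinearMap.proj i)
    (s := Finset.univ.erase (Sum.inl j₀))
    (F := Sum.elim (fun j x => -ψ j x) g) (ψ := ψ j₀)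
    ⟨Pi.single i₁ (A i₁ j₀)⁻¹, by simp [hcol, Pi.single_apply, h₁]⟩ (by
      rintro (j | i) hk
      · have hj : j ≠ j₀ := fun h => by simp [h] at hk
        have hv (j : ι) : col j (Matrix.vecMul (Pi.single j₀ 1) A⁻¹) = (Pi.single j₀ 1 : ι → ℝ) j := by
          have : Matrix.vecMul (Matrix.vecMul (Pi.single j₀ 1) A⁻¹) A = Pi.single j₀ 1 := by
            rw [Matrix.vecMul_vecMul, Matrix.nonsing_inv_mul _ hA, Matrix.vecMul_one]
          exact (hcol j _).trans (congrFun this j)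
        exact ⟨_, (hv j).trans (by simp [hj]), (hv j₀).trans (by simp)⟩
      · by_cases h : i = i₁
        · refine ⟨Pi.single i₂ (A i₂ j₀)⁻¹, ?_, by simp [hcol, Pi.single_apply, h₂]⟩
          simp [h, hi]
        · refine ⟨Pi.single i₁ (A i₁ j₀)⁻¹, ?_, by simp [hcol, Pi.single_apply, h₁]⟩
          simp [h])
    (hψ j₀) (by rintro (j | i); exacts [(hψ j).neg, hg i]) (by
      filter_upwards [hzero] with w hw
      have h1 := Finset.add_sum_erase Finset.univ (fun k => (Sum.elim (fun j x => -ψ j x) g :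
        ι ⊕ ι → ℝ → ℂ) k ((Sum.elim col fun i => ContinuousLinearMap.proj i :
        ι ⊕ ι → (ι → ℝ) →L[ℝ] ℝ) k w)) (Finset.mem_univ (Sum.inl j₀))
      rw [Fintype.sum_sum_type] at h1
      simp only [Sum.elim_inl, Sum.elim_inr, ContinuousLinearMap.proj_apply,
        Finset.sum_neg_distrib] at h1
      linear_combination hw - h1)
  have := hprob _ (hm j₀)
  obtain ⟨m, v, hmv⟩ := exists_eq_gaussianReal_of_charFun_eventually_eq (μ := P.map (X j₀))
    (Q := Q) (by filter_upwards [hQ, hψe j₀] with t ht₁ ht₂; rw [← ht₁, ht₂])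
  exact ⟨hmv ▸ inferInstance⟩

/-- A matrix with independent inputs and independent outputs has at most one non-zero entry in each
column, provided at most one of the inputs is Gaussian and none is almost surely constant. -/
theorem eq_of_iIndepFun_mixture [IsProbabilityMeasure P] [DecidableEq ι] (hA : IsUnit A.det)
    (hm : ∀ i, AEMeasurable (X i) P) (hX : iIndepFun X P)
    (hY : iIndepFun (fun i ω => ∑ j, A i j * X j ω) P)
    (hgauss : ∀ i j, HasGaussianLaw (X i) P → HasGaussianLaw (X j) P → i = j)
    (hdirac : ∀ i c, P.map (X i) ≠ Measure.dirac c) {j i k : ι}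
    (hi : A i j ≠ 0) (hk : A k j ≠ 0) : i = k := by
  by_contra hik
  have hprob (l : ι) : IsProbabilityMeasure (P.map (X l)) := Measure.isProbabilityMeasure_map (hm l)
  have hj := hasGaussianLaw_of_iIndepFun_mixture hA hm hX hY hik hi hk
  have hother (l : ι) (hl : l ≠ j) : A i l = 0 ∨ A k l = 0 := by
    by_contra! h
    exact hl (hgauss _ _ (hasGaussianLaw_of_iIndepFun_mixture hA hm hX hY hik h.1 h.2) hj)
  set φ : ι → ℝ → ℂ := fun l => charFun (P.map (X l)) with hφ
  have hφ0 (l : ι) : φ l 0 = 1 := by simp [hφ]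
  have hmY (i : ι) : AEMeasurable (fun ω => ∑ j, A i j * X j ω) P := by fun_prop
  have hf0 (i : ι) : charFun (P.map fun ω => ∑ j, A i j * X j ω) 0 = 1 := by
    have := Measure.isProbabilityMeasure_map (μ := P) (hmY i)
    simp
  have hsingle (i : ι) (α : ℝ) :
      charFun (P.map fun ω => ∑ j, A i j * X j ω) α = ∏ l, φ l (α * A i l) := by
    have := (prod_charFun_eq_prod_charFun hm hX hY (Pi.single i α)).symm
    rw [Finset.prod_eq_single i (fun l _ hl => by rw [Pi.single_eq_of_ne hl, hf0]) (by simp),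
      Pi.single_eq_same] at this
    simpa [Pi.single_apply, hφ] using this
  have hpair (α β : ℝ) : ∏ l, φ l (α * A i l + β * A k l)
      = (∏ l, φ l (α * A i l)) * ∏ l, φ l (β * A k l) := by
    have := (prod_charFun_eq_prod_charFun hm hX hY (Pi.single i α + Pi.single k β)).symm
    rw [Finset.prod_eq_mul i k hik (fun l _ hl => by simp [hl.1, hl.2, hf0]) (by simp)
      (by simp)] at this
    rw [← hsingle, ← hsingle]
    simpa [Pi.single_apply, add_mul, Finset.sum_add_distrib, hik, Ne.symm hik, hφ] using this.symm
  have hne : ∀ᶠ t : ℝ in 𝓝 0, ∀ l, φ l (t / A i j * A i l) ≠ 0 ∧ φ l (t / A k j * A k l) ≠ 0 := by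
    refine eventually_all.2 fun l => ?_
    have h (a b : ℝ) : ∀ᶠ t : ℝ in 𝓝 0, φ l (t / a * b) ≠ 0 := by
      have hc : Continuous fun t : ℝ => φ l (t / a * b) :=
        continuous_charFun.comp (by fun_prop)
      exact hc.continuousAt.eventually_ne (by simp [hφ0])
    exact (h _ _).and (h _ _)
  obtain ⟨t, ht, ht0⟩ := ((hne.filter_mono nhdsWithin_le_nhds).and
    (eventually_mem_nhdsWithin (a := (0 : ℝ)) (s := {0}ᶜ))).exists
  -- The arguments `t / A i j` and `t / A k j` both reach source `j` as `t`. Every other source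
  -- enters at most one of the two rows, so its factors agree on both sides and, being non-zero near
  -- zero, cancel. For a Gaussian this identity at a single `t ≠ 0` forces zero variance.
  have hdouble : φ j (t + t) = φ j t * φ j t := by
    have h1 := hpair (t / A i j) (t / A k j)
    rw [← Finset.prod_mul_distrib, ← Finset.mul_prod_erase _ _ (Finset.mem_univ j),
      ← Finset.mul_prod_erase (a := j) _ (fun l => φ l (t / A i j * A i l) * _)
        (Finset.mem_univ j), div_mul_cancel₀ _ hi, div_mul_cancel₀ _ hk] at h1
    have h2 : ∏ l ∈ Finset.univ.erase j, φ l (t / A i j * A i l + t / A k j * A k l)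
        = ∏ l ∈ Finset.univ.erase j, φ l (t / A i j * A i l) * φ l (t / A k j * A k l) := by
      refine Finset.prod_congr rfl fun l hl => ?_
      rcases hother l (Finset.ne_of_mem_erase hl) with h | h <;> simp [h, hφ0]
    rw [h2] at h1
    exact mul_right_cancel₀ (Finset.prod_ne_zero_iff.2 fun l _ => mul_ne_zero (ht l).1 (ht l).2) h1
  have hlaw := hj.map_eq_gaussianReal
  set v := Var[X j; P].toNNReal
  have hnorm (t : ℝ) : ‖φ j t‖ = Real.exp (-(v * t ^ 2 / 2)) := by
    rw [hφ]
    simp only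
    rw [hlaw, charFun_gaussianReal, Complex.norm_exp]
    congr 1
    simp [← Complex.ofReal_pow]
  have hv : (v : ℝ) = 0 := by
    have h1 := congrArg norm hdouble
    rw [norm_mul, hnorm, hnorm, ← Real.exp_add, Real.exp_eq_exp] at h1
    have h2 : (v : ℝ) * t ^ 2 = 0 := by linear_combination -h1
    exact (mul_eq_zero.1 h2).resolve_right (pow_ne_zero _ ht0)
  have hv' : v = 0 := by exact_mod_cast hv
  rw [hv', gaussianReal_zero_var] at hlaw
  exact hdirac j _ hlaw

end Darmois

/-- An invertible matrix with at most one non-zero entry in each column is a permutation of the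
coordinates followed by a scaling of each of them. -/
lemma exists_perm_eq_diagonal_mul_permMatrix {ι : Type*} [Fintype ι] [DecidableEq ι]
    {A : Matrix ι ι ℝ} (hA : IsUnit A.det) (h : ∀ i j k, A i j ≠ 0 → A k j ≠ 0 → i = k) :
    ∃ (σ : Equiv.Perm ι) (t : ι → ℝ), (∀ i, t i ≠ 0) ∧
      A = Matrix.diagonal t * σ.permMatrix ℝ := by
  have hrow (i : ι) : ∃ j, A i j ≠ 0 := by
    by_contra! h0
    exact hA.ne_zero (Matrix.det_eq_zero_of_row_eq_zero i h0)
  choose σ hσ using hrow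
  have hinj : Function.Injective σ := fun i k hik => h i (σ i) k (hσ i) (hik ▸ hσ k)
  let e : Equiv.Perm ι := Equiv.ofBijective σ (Finite.injective_iff_bijective.1 hinj)
  refine ⟨e, fun i => A i (σ i), hσ, ?_⟩
  ext i j
  rw [Matrix.diagonal_mul, Equiv.Perm.permMatrix, PEquiv.toMatrix_apply]
  by_cases hij : σ i = j
  · simp [e, hij]
  · have : A i j = 0 := by
      by_contra hne
      obtain ⟨k, rfl⟩ := e.surjective j
      exact hij (congrArg σ (h i _ k hne (hσ k)))
    simp [e, hij, this]

end BSS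

/-! ### Densities in `Lᵖ`: products, affine changes of variables, convolution. -/

namespace BSS

open scoped ENNReal

section Lp

lemma rpow_lintegral_le_lintegral_rpow {α : Type*} [MeasurableSpace α] {ν : Measure α}
    [IsProbabilityMeasure ν] {p : ℝ} (hp : 1 ≤ p) {f : α → ℝ≥0∞} (hf : Measurable f) :
    (∫⁻ x, f x ∂ν) ^ p ≤ ∫⁻ x, f x ^ p ∂ν := by
  have h := eLpNorm'_le_eLpNorm'_of_exponent_le one_pos hp ν hf.aestronglyMeasurable
  simp only [eLpNorm', enorm_eq_self, ENNReal.rpow_one, div_one] at h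
  have hp0 : 0 < p := by linarith
  calc _ ≤ ((∫⁻ x, f x ^ p ∂ν) ^ (1 / p)) ^ p := ENNReal.rpow_le_rpow h hp0.le
    _ = _ := by rw [← ENNReal.rpow_mul, one_div_mul_cancel hp0.ne', ENNReal.rpow_one]

lemma ofReal_ne_zero_of_one_le {p : ℝ} (hp : 1 ≤ p) : ENNReal.ofReal p ≠ 0 := by
  simp; linarith

lemma memLp_iff_integrable_abs_rpow {α : Type*} [MeasurableSpace α] {μ : Measure α} {p : ℝ}
    (hp : 1 ≤ p) {f : α → ℝ} (hf : AEStronglyMeasurable f μ) :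
    MemLp f (ENNReal.ofReal p) μ ↔ Integrable (fun x => |f x| ^ p) μ := by
  rw [← integrable_norm_rpow_iff hf (ofReal_ne_zero_of_one_le hp) ENNReal.ofReal_ne_top,
    ENNReal.toReal_ofReal (by linarith)]
  rfl

lemma memLp_toReal_iff {α : Type*} [MeasurableSpace α] {μ : Measure α} {p : ℝ} (hp : 1 ≤ p)
    {f : α → ℝ≥0∞} (hf : AEMeasurable f μ) (hfin : ∀ᵐ x ∂μ, f x < ∞) :
    MemLp (fun x => (f x).toReal) (ENNReal.ofReal p) μ ↔ ∫⁻ x, f x ^ p ∂μ < ∞ := by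
  have hm : AEStronglyMeasurable (fun x => (f x).toReal) μ := hf.ennreal_toReal.aestronglyMeasurable
  rw [MemLp, and_iff_right hm, eLpNorm_lt_top_iff_lintegral_rpow_enorm_lt_top
    (ofReal_ne_zero_of_one_le hp) ENNReal.ofReal_ne_top, ENNReal.toReal_ofReal (by linarith)]
  have : ∫⁻ x, ‖(f x).toReal‖ₑ ^ p ∂μ = ∫⁻ x, f x ^ p ∂μ := by
    refine lintegral_congr_ae ?_
    filter_upwards [hfin] with x hx
    rw [Real.enorm_of_nonneg ENNReal.toReal_nonneg, ENNReal.ofReal_toReal hx.ne]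
  rw [this]

variable {ι : Type*} [Fintype ι]

lemma memLp_prod_eval {p : ℝ} (hp : 1 ≤ p) {f : ι → ℝ → ℝ}
    (hf : ∀ i, MemLp (f i) (ENNReal.ofReal p) volume) :
    MemLp (fun u : ι → ℝ => ∏ i, f i (u i)) (ENNReal.ofReal p) volume := by
  have hm (i : ι) : AEStronglyMeasurable (fun u : ι → ℝ => f i (u i)) volume :=
    (hf i).1.comp_quasiMeasurePreserving (Measure.quasiMeasurePreserving_eval (fun _ => volume) i)
  rw [memLp_iff_integrable_abs_rpow hp (Finset.aestronglyMeasurable_fun_prod _ fun i _ => hm i)]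
  have := Integrable.fintype_prod (ι := ι) (f := fun i x => |f i x| ^ p)
    (μ := fun _ => (volume : Measure ℝ))
    fun i => (memLp_iff_integrable_abs_rpow hp (hf i).1).1 (hf i)
  refine this.congr (ae_of_all _ fun u => ?_)
  simp only [Finset.abs_prod]
  exact Real.finsetProd_rpow _ _ (fun i _ => abs_nonneg _) _

lemma pi_withDensity_ofReal {q : ι → ℝ → ℝ} (hq : ∀ i, Integrable (q i))
    (hpos : ∀ i x, 0 ≤ q i x) :
    Measure.pi (fun i => (volume : Measure ℝ).withDensity fun x => ENNReal.ofReal (q i x))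
      = (volume : Measure (ι → ℝ)).withDensity fun u => ENNReal.ofReal (∏ i, q i (u i)) := by
  have (i : ι) : IsFiniteMeasure ((volume : Measure ℝ).withDensity fun x => ENNReal.ofReal (q i x)) :=
    isFiniteMeasure_withDensity_ofReal (hq i).2
  refine Measure.pi_eq fun s hs => ?_
  have hq' (i : ι) : Integrable ((s i).indicator (q i)) := (hq i).indicator (hs i)
  have hpos' (i : ι) (x : ℝ) : 0 ≤ (s i).indicator (q i) x :=
    Set.indicator_nonneg (fun x _ => hpos i x) x
  have h1 (i : ι) : (volume : Measure ℝ).withDensity (fun x => ENNReal.ofReal (q i x)) (s i)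
      = ENNReal.ofReal (∫ x, (s i).indicator (q i) x) := by
    rw [withDensity_apply _ (hs i), integral_indicator (hs i), ofReal_integral_eq_lintegral_ofReal
      (hq i).integrableOn (ae_of_all _ (hpos i))]
  have hI : Integrable (fun u : ι → ℝ => ∏ i, (s i).indicator (q i) (u i)) :=
    Integrable.fintype_prod (μ := fun _ => volume) hq'
  simp_rw [h1]
  rw [← ENNReal.ofReal_prod_of_nonneg fun i _ => integral_nonneg (hpos' i),
    ← integral_fintype_prod_volume_eq_prod (𝕜 := ℝ) (fun i => (s i).indicator (q i)),
    ofReal_integral_eq_lintegral_ofReal hI (ae_of_all _ fun u => Finset.prod_nonneg fun i _ => hpos' i _),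
    withDensity_apply _ (MeasurableSet.univ_pi hs), ← lintegral_indicator (MeasurableSet.univ_pi hs)]
  refine lintegral_congr fun u => ?_
  by_cases hu : u ∈ Set.univ.pi s
  · rw [Set.indicator_of_mem hu]
    congr 1
    exact Finset.prod_congr rfl fun i _ => (Set.indicator_of_mem (hu i (Set.mem_univ i)) _).symm
  · rw [Set.indicator_of_notMem hu]
    simp only [Set.mem_univ_pi, not_forall] at hu
    obtain ⟨i, hi⟩ := hu
    rw [Finset.prod_eq_zero (Finset.mem_univ i) (Set.indicator_of_notMem hi _), ENNReal.ofReal_zero]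

end Lp

section Scaling

variable {E Ω : Type*} [MeasurableSpace E] [MeasurableSpace Ω] {P : Measure Ω}
  {m : Measure E} {f : E → E} {c : ℝ≥0∞}

lemma ae_comp_of_map_eq_smul (hf : Measurable f) (hmap : m.map f = c • m) {q : E → Prop}
    (hq : ∀ᵐ x ∂m, q x) : ∀ᵐ x ∂m, q (f x) := by
  refine ae_of_ae_map hf.aemeasurable ?_
  rw [hmap]
  exact Measure.smul_absolutelyContinuous.ae_le hq

/-- The hypothesis `m.map f = c • m` treats affine maps of `ℝ` and of `ℝⁿ` at once, with `c` the
inverse absolute determinant. Pushing law and reference measure forward together leaves the density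
unchanged; replacing `c • m` by `m` yields the factor `c`. -/
lemma pdf_comp_measurableEmbedding [IsFiniteMeasure P] [SigmaFinite m] {X : Ω → E} (hX : AEMeasurable X P)
    (hf : MeasurableEmbedding f) (hc : c ≠ 0) (hc' : c ≠ ∞) (hmap : m.map f = c • m) :
    ∀ᵐ u ∂m, pdf (fun ω => f (X ω)) P m (f u) = c * pdf X P m u := by
  have hX' : AEMeasurable (fun ω => f (X ω)) P := hf.measurable.comp_aemeasurable hX
  have h1 := hf.rnDeriv_map (P.map X) m
  rw [hmap, AEMeasurable.map_map_of_aemeasurable hf.measurable.aemeasurable hX] at h1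
  have h2 := ae_comp_of_map_eq_smul hf.measurable hmap
    (Measure.rnDeriv_smul_right_of_ne_top (P.map fun ω => f (X ω)) m hc hc')
  filter_upwards [h1, h2] with u hu₁ hu₂
  simp only [pdf_def]
  rw [← hu₁, Function.comp_def, hu₂, Pi.smul_apply, smul_eq_mul, ← mul_assoc,
    ENNReal.mul_inv_cancel hc hc', one_mul]

lemma memLp_comp_iff_of_map_eq_smul {p : ℝ≥0∞} (hf : MeasurableEmbedding f) (hc : c ≠ 0)
    (hc' : c ≠ ∞) (hmap : m.map f = c • m) {g : E → ℝ} :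
    MemLp (fun x => g (f x)) p m ↔ MemLp g p m := by
  change MemLp (g ∘ f) p m ↔ _
  rw [← hf.memLp_map_measure_iff, hmap]
  refine ⟨fun h => ?_, fun h => h.smul_measure hc'⟩
  have := h.smul_measure (ENNReal.inv_ne_top.2 hc)
  rwa [smul_smul, ENNReal.inv_mul_cancel hc hc', one_smul] at this

lemma hasPDF_comp_measurableEmbedding [IsFiniteMeasure P] [SigmaFinite m] {X : Ω → E} [HasPDF X P m]
    (hf : MeasurableEmbedding f) (hmap : m.map f = c • m) :
    HasPDF (fun ω => f (X ω)) P m :=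
  pdf.quasiMeasurePreserving_hasPDF' X
    ⟨hf.measurable, hmap ▸ Measure.smul_absolutelyContinuous⟩

lemma memLp_pdf_comp_measurableEmbedding [IsFiniteMeasure P] [SigmaFinite m] {X : Ω → E} (hX : AEMeasurable X P)
    {p : ℝ≥0∞} (hf : MeasurableEmbedding f) (hc : c ≠ 0) (hc' : c ≠ ∞) (hmap : m.map f = c • m)
    (h : MemLp (fun u => (pdf X P m u).toReal) p m) :
    MemLp (fun u => (pdf (fun ω => f (X ω)) P m u).toReal) p m := by
  rw [← memLp_comp_iff_of_map_eq_smul hf hc hc' hmap]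
  refine (h.const_mul c.toReal).ae_eq ?_
  filter_upwards [pdf_comp_measurableEmbedding hX hf hc hc' hmap] with u hu
  rw [hu, ENNReal.toReal_mul]

end Scaling

section Affine

lemma measurableEmbedding_mul_add {t : ℝ} (ht : t ≠ 0) (b : ℝ) :
    MeasurableEmbedding fun x : ℝ => t * x + b :=
  ((Homeomorph.mulLeft₀ t ht).trans (Homeomorph.addRight b)).measurableEmbedding

lemma map_mul_add_volume {t : ℝ} (ht : t ≠ 0) (b : ℝ) :
    (volume : Measure ℝ).map (fun x => t * x + b) = ENNReal.ofReal |t⁻¹| • volume := by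
  have h : (fun x : ℝ => t * x + b) = (· + b) ∘ (t * ·) := rfl
  rw [h, ← Measure.map_map (by fun_prop) (by fun_prop), Real.map_volume_mul_left ht,
    Measure.map_smul, (measurePreserving_add_right volume b).map_eq]

variable {n : ℕ} {M : Matrix (Fin n) (Fin n) ℝ}

lemma measurableEmbedding_mulVec_add (hM : M.det ≠ 0) (b : Fin n → ℝ) :
    MeasurableEmbedding fun u : Fin n → ℝ => M.mulVec u + b := by
  have hu : IsUnit M := (Matrix.isUnit_iff_isUnit_det _).2 hM.isUnit
  refine Continuous.measurableEmbedding (by fun_prop) fun u v h => ?_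
  exact Matrix.mulVec_injective_of_isUnit hu (add_right_cancel h)

lemma map_mulVec_add_volume (hM : M.det ≠ 0) (b : Fin n → ℝ) :
    (volume : Measure (Fin n → ℝ)).map (fun u => M.mulVec u + b)
      = ENNReal.ofReal |M.det⁻¹| • volume := by
  have h : (fun u : Fin n → ℝ => M.mulVec u + b) = (· + b) ∘ (Matrix.toLin' M) := rfl
  rw [h, ← Measure.map_map (by fun_prop) (LinearMap.continuous_of_finiteDimensional _).measurable,
    Real.map_matrix_volume_pi_eq_smul_volume_pi hM, Measure.map_smul,
    (measurePreserving_add_right volume b).map_eq]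

lemma ofReal_abs_inv_ne_zero {t : ℝ} (ht : t ≠ 0) : ENNReal.ofReal |t⁻¹| ≠ 0 := by
  simp [ht]

end Affine

section Sum

variable {Ω : Type*} [MeasurableSpace Ω] {P : Measure Ω} [IsProbabilityMeasure P]

/-- Adding an independent random variable keeps the density in `Lᵖ`. -/
lemma memLp_pdf_add {X Z : Ω → ℝ} (hXZ : IndepFun X Z P) [HasPDF X P volume]
    (hZ : AEMeasurable Z P) {p : ℝ} (hp : 1 ≤ p)
    (h : MemLp (fun u => (pdf X P volume u).toReal) (ENNReal.ofReal p) volume) :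
    MemLp (fun u => (pdf (X + Z) P volume u).toReal) (ENNReal.ofReal p) volume := by
  have hX : AEMeasurable X P := HasPDF.aemeasurable X P volume
  set f := pdf X P volume with hf
  have hfm : Measurable f := measurable_pdf X P volume
  set ν := P.map Z
  have : IsProbabilityMeasure ν := Measure.isProbabilityMeasure_map hZ
  set g : ℝ → ℝ≥0∞ := fun u => ∫⁻ z, f (u - z) ∂ν
  have hgm : Measurable g := Measurable.lintegral_prod_right (by fun_prop)
  have hmap : P.map (X + Z) = volume.withDensity g := by
    refine Measure.ext_of_lintegral _ fun φ hφ => ?_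
    rw [hXZ.map_add_eq_map_conv_map₀ hX hZ, Measure.conv_comm, Measure.lintegral_conv hφ,
      lintegral_withDensity_eq_lintegral_mul _ hgm hφ, map_eq_withDensity_pdf X P volume]
    have h1 (z : ℝ) : ∫⁻ x, φ (z + x) ∂(volume.withDensity f) = ∫⁻ u, f (u - z) * φ u := by
      rw [lintegral_withDensity_eq_lintegral_mul _ hfm (by fun_prop)]
      refine (lintegral_sub_right_eq_self (fun x => f x * φ (z + x)) z).symm.trans ?_
      simp
    calc _ = ∫⁻ z, ∫⁻ u, f (u - z) * φ u ∂volume ∂ν := lintegral_congr h1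
      _ = ∫⁻ u, ∫⁻ z, f (u - z) * φ u ∂ν ∂volume :=
          lintegral_lintegral_swap (by fun_prop)
      _ = _ := lintegral_congr fun u => by
          rw [lintegral_mul_const _ (by fun_prop)]
          rfl
  have : HasPDF (X + Z) P volume :=
    hasPDF_of_map_eq_withDensity (hX.add hZ) g hgm.aemeasurable hmap
  have hpdf := (pdf.eq_of_map_eq_withDensity g hgm.aemeasurable).1 hmap
  rw [memLp_toReal_iff hp (measurable_pdf _ _ _).aemeasurable pdf.ae_lt_top] at h ⊢
  -- Jensen under the law of `Z`, then Tonelli and translation invariance. `Z` needs no density.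
  calc ∫⁻ u, pdf (X + Z) P volume u ^ p = ∫⁻ u, g u ^ p :=
        lintegral_congr_ae (hpdf.mono fun u hu => by simp only [hu])
    _ ≤ ∫⁻ u, ∫⁻ z, f (u - z) ^ p ∂ν ∂volume :=
        lintegral_mono fun u => rpow_lintegral_le_lintegral_rpow hp (by fun_prop)
    _ = ∫⁻ z, ∫⁻ u, f (u - z) ^ p ∂volume ∂ν := lintegral_lintegral_swap (by fun_prop)
    _ = ∫⁻ _, ∫⁻ u, f u ^ p ∂volume ∂ν :=
        lintegral_congr fun z => lintegral_sub_right_eq_self (fun u => f u ^ p) z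
    _ < ∞ := by simpa using h

end Sum

end BSS

/-! ### Laws, independence and scaling of the Function Difference. -/

namespace BSS

open scoped ENNReal

lemma mix_one {n : ℕ} {Ω : Type*} {x : Ω → Fin n → ℝ} : mix 1 x = x := by
  ext ω i
  simp [mix]

lemma mix_mix {n : ℕ} {Ω : Type*} {x : Ω → Fin n → ℝ} (H K : LinearFilter n) :
    mix H (mix K x) = mix (H * K) x := by
  ext ω i
  simp [mix, Matrix.mulVec_mulVec]

section Law

variable {n : ℕ} {Ω : Type*} [MeasurableSpace Ω] {P : Measure Ω} {x x' : Ω → Fin n → ℝ}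

lemma aemeasurable_comp (hx : AEMeasurable x P) (i : Fin n) : AEMeasurable (comp x i) P :=
  (measurable_pi_apply i).comp_aemeasurable hx

lemma map_comp (hx : AEMeasurable x P) (i : Fin n) :
    P.map (comp x i) = (P.map x).map fun u => u i :=
  (AEMeasurable.map_map_of_aemeasurable (measurable_pi_apply i).aemeasurable hx).symm

lemma aemeasurable_mix (hx : AEMeasurable x P) (H : LinearFilter n) : AEMeasurable (mix H x) P :=
  (show Continuous fun u : Fin n → ℝ => (H : Matrix (Fin n) (Fin n) ℝ).mulVec u by
    fun_prop).measurable.comp_aemeasurable hx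

lemma map_mix (hx : AEMeasurable x P) (H : LinearFilter n) :
    P.map (mix H x) = (P.map x).map fun u => (H : Matrix (Fin n) (Fin n) ℝ).mulVec u :=
  (AEMeasurable.map_map_of_aemeasurable (show Continuous fun u : Fin n → ℝ =>
    (H : Matrix (Fin n) (Fin n) ℝ).mulVec u by fun_prop).measurable.aemeasurable hx).symm

lemma fdNorm_eq_of_map_eq (p : ℝ) (hx : AEMeasurable x P) (hx' : AEMeasurable x' P)
    (h : P.map x = P.map x') : fdNorm p P x = fdNorm p P x' := by
  have : functionDifference P x = functionDifference P x' := by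
    ext u
    simp only [functionDifference, pdf_def, map_comp hx, map_comp hx', h]
  rw [fdNorm, fdNorm, this]

lemma aemeasurable_normalize (hx : AEMeasurable x P) : AEMeasurable (normalize P x) P :=
  aemeasurable_pi_iff.2 fun i => ((aemeasurable_comp hx i).sub_const _).div_const _

/-- Means and variances are functionals of the law, so the law of the normalized vector is
determined by that of `x`. -/
lemma map_normalize (hx : AEMeasurable x P) :
    P.map (normalize P x) = (P.map x).map fun u i =>
      (u i - ∫ v, v i ∂(P.map x)) / Real.sqrt (variance (fun v => v i) (P.map x)) := by
  rw [AEMeasurable.map_map_of_aemeasurable (Measurable.aemeasurable (by fun_prop)) hx]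
  congr 1
  ext ω i
  rw [Function.comp, integral_map hx (measurable_pi_apply i).aestronglyMeasurable,
    variance_map (measurable_pi_apply i).aemeasurable hx]
  rfl

lemma map_eq_of_pdf_ae_eq [HasPDF x P volume] [HasPDF x' P volume]
    (h : pdf x P volume =ᵐ[volume] pdf x' P volume) : P.map x = P.map x' := by
  rw [map_eq_withDensity_pdf x P volume, map_eq_withDensity_pdf x' P volume,
    withDensity_congr_ae h]

lemma dependsOnlyOnPDF_rawContrast {S : Set (Ω → Fin n → ℝ)} (p : ℝ)
    (hS : ∀ x ∈ mixtures S, HasPDF x P volume) : DependsOnlyOnPDF P S (rawContrast p P) := by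
  intro x hx x' hx' h H
  have := hS x hx
  have := hS x' hx'
  have hm := HasPDF.aemeasurable x P volume
  have hm' := HasPDF.aemeasurable x' P volume
  rw [rawContrast, rawContrast, fdNorm_eq_of_map_eq p (aemeasurable_mix hm H)
    (aemeasurable_mix hm' H)]
  rw [map_mix hm, map_mix hm', map_eq_of_pdf_ae_eq h]

lemma dependsOnlyOnPDF_normalizedContrast {S : Set (Ω → Fin n → ℝ)} (p : ℝ)
    (hS : ∀ x ∈ mixtures S, HasPDF x P volume) :
    DependsOnlyOnPDF P S (normalizedContrast p P) := by
  intro x hx x' hx' h H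
  have := hS x hx
  have := hS x' hx'
  have hm := aemeasurable_mix (HasPDF.aemeasurable x P volume) H
  have hm' := aemeasurable_mix (HasPDF.aemeasurable x' P volume) H
  have hmap : P.map (mix H x) = P.map (mix H x') := by
    rw [map_mix (HasPDF.aemeasurable x P volume), map_mix (HasPDF.aemeasurable x' P volume),
      map_eq_of_pdf_ae_eq h]
  rw [normalizedContrast, normalizedContrast, fdNorm_eq_of_map_eq p (aemeasurable_normalize hm)
    (aemeasurable_normalize hm')]
  rw [map_normalize hm, map_normalize hm', hmap]

lemma measurable_prod_pdf : Measurable fun u : Fin n → ℝ =>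
    ∏ i, (pdf (comp x i) P volume (u i)).toReal :=
  Finset.measurable_fun_prod _ fun i _ =>
    ((measurable_pdf (comp x i) P volume).comp (measurable_pi_apply i)).ennreal_toReal

lemma fdNorm_nonneg {p : ℝ} : 0 ≤ fdNorm p P x :=
  Real.rpow_nonneg (integral_nonneg fun u => by positivity) _

lemma map_ne_dirac {X : Ω → ℝ} [HasPDF X P volume] (c : ℝ) : P.map X ≠ Measure.dirac c := by
  intro h
  have hac : P.map X ≪ volume := HasPDF.absolutelyContinuous
  rw [h] at hac
  simpa using hac (Real.volume_singleton (a := c))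

end Law

section Density

variable {n : ℕ} {Ω : Type*} [MeasurableSpace Ω] {P : Measure Ω} [IsProbabilityMeasure P]
  {x : Ω → Fin n → ℝ} {p : ℝ}

lemma hasPDF_comp [HasPDF x P volume] (i : Fin n) : HasPDF (comp x i) P volume :=
  pdf.quasiMeasurePreserving_hasPDF' x (Measure.quasiMeasurePreserving_eval (fun _ => volume) i)

lemma hasPDF_mix [HasPDF x P volume] (H : LinearFilter n) : HasPDF (mix H x) P volume := by
  have hdet := Matrix.GeneralLinearGroup.det_ne_zero H
  have h := hasPDF_comp_measurableEmbedding (X := x) (P := P)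
    (measurableEmbedding_mulVec_add hdet 0) (map_mulVec_add_volume hdet 0)
  simp only [add_zero] at h
  exact h

lemma pdf_ae_eq_ofReal_toReal {X : Ω → ℝ} :
    (fun u => ENNReal.ofReal (pdf X P volume u).toReal) =ᵐ[volume] pdf X P volume :=
  pdf.ofReal_toReal_ae_eq

lemma iIndepFun_iff_map_eq_withDensity (hpdf : ∀ i, HasPDF (comp x i) P volume) :
    iIndepFun (fun i => comp x i) P ↔ P.map x = volume.withDensity
      fun u => ENNReal.ofReal (∏ i, (pdf (comp x i) P volume (u i)).toReal) := by
  rw [iIndepFun_iff_map_fun_eq_pi_map fun i => HasPDF.aemeasurable (comp x i) P volume,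
    ← pi_withDensity_ofReal (q := fun i u => (pdf (comp x i) P volume u).toReal)
      (fun i => integrable_toReal_of_lintegral_ne_top (measurable_pdf _ _ _).aemeasurable
        (by rw [pdf.lintegral_eq_measure_univ]; exact measure_ne_top _ _))
      fun i u => ENNReal.toReal_nonneg]
  have (i : Fin n) : (volume : Measure ℝ).withDensity
      (fun u => ENNReal.ofReal (pdf (comp x i) P volume u).toReal) = P.map (comp x i) := by
    rw [withDensity_congr_ae pdf_ae_eq_ofReal_toReal, map_eq_withDensity_pdf (comp x i) P volume]
  simp_rw [this]
  rfl

lemma hasPDF_of_iIndepFun (hpdf : ∀ i, HasPDF (comp x i) P volume)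
    (h : iIndepFun (fun i => comp x i) P) : HasPDF x P volume :=
  hasPDF_of_map_eq_withDensity
    (aemeasurable_pi_iff.2 fun i => HasPDF.aemeasurable (comp x i) P volume) _
    measurable_prod_pdf.ennreal_ofReal.aemeasurable ((iIndepFun_iff_map_eq_withDensity hpdf).1 h)

/-- The Function Difference vanishes exactly when the components are independent. -/
lemma iIndepFun_iff_functionDifference_ae_eq_zero [HasPDF x P volume] :
    iIndepFun (fun i => comp x i) P ↔ functionDifference P x =ᵐ[volume] 0 := by
  rw [iIndepFun_iff_map_eq_withDensity hasPDF_comp,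
    pdf.eq_of_map_eq_withDensity _ measurable_prod_pdf.ennreal_ofReal.aemeasurable]
  have hpos (u : Fin n → ℝ) : 0 ≤ ∏ i, (pdf (comp x i) P volume (u i)).toReal :=
    Finset.prod_nonneg fun i _ => ENNReal.toReal_nonneg
  constructor
  · intro h
    filter_upwards [h] with u hu
    simp [functionDifference, hu, ENNReal.toReal_ofReal (hpos u)]
  · intro h
    have hfin : ∀ᵐ u, pdf x P volume u < ∞ := pdf.ae_lt_top
    filter_upwards [h, hfin] with u hu hlt
    rw [functionDifference, Pi.zero_apply, sub_eq_zero] at hu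
    rw [hu, ENNReal.ofReal_toReal hlt.ne]

lemma fdNorm_eq_zero_of_iIndepFun (hp : 1 ≤ p) [HasPDF x P volume]
    (h : iIndepFun (fun i => comp x i) P) : fdNorm p P x = 0 := by
  have h0 := iIndepFun_iff_functionDifference_ae_eq_zero.1 h
  have hp0 : p ≠ 0 := by linarith
  rw [fdNorm, integral_eq_zero_of_ae, Real.zero_rpow (one_div_ne_zero hp0)]
  filter_upwards [h0] with u hu
  simp [hu, Real.zero_rpow hp0]

/-- The `Lᵖ` membership is essential: the Bochner integral of a non-integrable function is `0` by
convention, so without it a zero norm would carry no information. -/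
lemma iIndepFun_of_fdNorm_eq_zero (hp : 1 ≤ p) (hx : HasFiniteFD p P x) (h : fdNorm p P x = 0) :
    iIndepFun (fun i => comp x i) P := by
  have := hx.joint
  have hp0 : p ≠ 0 := by linarith
  rw [iIndepFun_iff_functionDifference_ae_eq_zero]
  have hnn : 0 ≤ fun u => |functionDifference P x u| ^ p := fun u => by positivity
  rw [fdNorm, Real.rpow_eq_zero (integral_nonneg hnn) (one_div_ne_zero hp0),
    integral_eq_zero_iff_of_nonneg hnn ((memLp_iff_integrable_abs_rpow hp hx.memLp.1).1 hx.memLp)]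
    at h
  filter_upwards [h] with u hu
  simpa using (Real.rpow_eq_zero (abs_nonneg _) hp0).1 hu

lemma hasFiniteFD_of_memLp (hp : 1 ≤ p) [hx : HasPDF x P volume]
    (hjoint : MemLp (fun u => (pdf x P volume u).toReal) (ENNReal.ofReal p) volume)
    (hmarg : ∀ i, MemLp (fun u => (pdf (comp x i) P volume u).toReal) (ENNReal.ofReal p) volume) :
    HasFiniteFD p P x :=
  ⟨hx, hasPDF_comp, (memLp_prod_eval hp hmarg).sub hjoint⟩

end Density

section Scaling

variable {n : ℕ} {Ω : Type*} [MeasurableSpace Ω] {P : Measure Ω} [IsProbabilityMeasure P]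
  {x : Ω → Fin n → ℝ} {p : ℝ} {σ : Equiv.Perm (Fin n)} {t : Fin n → ℝ}

lemma diagonal_mul_permMatrix_mulVec (σ : Equiv.Perm (Fin n)) (t u : Fin n → ℝ) (i : Fin n) :
    (Matrix.diagonal t * σ.permMatrix ℝ).mulVec u i = t i * u (σ i) := by
  rw [← Matrix.mulVec_mulVec, Matrix.mulVec_diagonal, Matrix.permMatrix_mulVec]
  rfl

lemma abs_det_diagonal_mul_permMatrix (σ : Equiv.Perm (Fin n)) (t : Fin n → ℝ) :
    |(Matrix.diagonal t * σ.permMatrix ℝ).det| = ∏ i, |t i| := by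
  rw [Matrix.det_mul, Matrix.det_diagonal, Matrix.det_permutation, abs_mul, Finset.abs_prod]
  rcases Int.units_eq_one_or (Equiv.Perm.sign σ) with h | h <;> simp [h]

lemma det_diagonal_mul_permMatrix_ne_zero (σ : Equiv.Perm (Fin n)) (ht : ∀ i, t i ≠ 0) :
    (Matrix.diagonal t * σ.permMatrix ℝ).det ≠ 0 := by
  rw [← abs_ne_zero, abs_det_diagonal_mul_permMatrix]
  exact Finset.prod_ne_zero_iff.2 fun i _ => abs_ne_zero.2 (ht i)

/-- Component `i` of the image is `t i * x (σ i) + b i`, so the marginal densities acquire factors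
`|t i|⁻¹` whose product is the factor of the joint density. The shift `b` is there to cover
centring. -/
lemma functionDifference_scale [HasPDF x P volume] (σ : Equiv.Perm (Fin n)) (ht : ∀ i, t i ≠ 0)
    (b : Fin n → ℝ) : ∀ᵐ u : Fin n → ℝ,
    functionDifference P (fun ω => (Matrix.diagonal t * σ.permMatrix ℝ).mulVec (x ω) + b)
      ((Matrix.diagonal t * σ.permMatrix ℝ).mulVec u + b)
      = |(Matrix.diagonal t * σ.permMatrix ℝ).det|⁻¹ * functionDifference P x u := by
  have hM := det_diagonal_mul_permMatrix_ne_zero σ ht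
  have hx := HasPDF.aemeasurable x P volume
  have hjoint := pdf_comp_measurableEmbedding hx (measurableEmbedding_mulVec_add hM b)
    (ofReal_abs_inv_ne_zero hM) ENNReal.ofReal_ne_top (map_mulVec_add_volume hM b)
  have hmarg (i : Fin n) := (Measure.quasiMeasurePreserving_eval
    (fun _ : Fin n => (volume : Measure ℝ)) (σ i)).ae (pdf_comp_measurableEmbedding
    (aemeasurable_comp hx (σ i)) (measurableEmbedding_mul_add (ht i) (b i))
    (ofReal_abs_inv_ne_zero (ht i)) ENNReal.ofReal_ne_top (map_mul_add_volume (ht i) (b i)))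
  filter_upwards [hjoint, ae_all_iff.2 hmarg] with u hu₁ hu₂
  have hcomp (i : Fin n) : comp (fun ω => (Matrix.diagonal t * σ.permMatrix ℝ).mulVec (x ω) + b) i
      = fun ω => t i * comp x (σ i) ω + b i := by
    ext ω
    simp only [comp, Pi.add_apply, diagonal_mul_permMatrix_mulVec]
  have hprod : ∏ i, (pdf (comp (fun ω => (Matrix.diagonal t * σ.permMatrix ℝ).mulVec (x ω) + b) i)
      P volume (((Matrix.diagonal t * σ.permMatrix ℝ).mulVec u + b) i)).toReal
      = |(Matrix.diagonal t * σ.permMatrix ℝ).det|⁻¹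
        * ∏ i, (pdf (comp x i) P volume (u i)).toReal := by
    rw [← Equiv.prod_comp σ fun i => (pdf (comp x i) P volume (u i)).toReal,
      abs_det_diagonal_mul_permMatrix, ← Finset.prod_inv_distrib, ← Finset.prod_mul_distrib]
    refine Finset.prod_congr rfl fun i _ => ?_
    rw [hcomp, Pi.add_apply, diagonal_mul_permMatrix_mulVec]
    have := hu₂ i
    simp only [Function.eval] at this
    rw [this, ENNReal.toReal_mul, ENNReal.toReal_ofReal (abs_nonneg _), abs_inv]
  rw [functionDifference, functionDifference, hprod, hu₁, ENNReal.toReal_mul,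
    ENNReal.toReal_ofReal (abs_nonneg _), abs_inv]
  ring

lemma hasFiniteFD_scale (hx : HasFiniteFD p P x) (σ : Equiv.Perm (Fin n)) (ht : ∀ i, t i ≠ 0)
    (b : Fin n → ℝ) : HasFiniteFD p P
      fun ω => (Matrix.diagonal t * σ.permMatrix ℝ).mulVec (x ω) + b := by
  have hM := det_diagonal_mul_permMatrix_ne_zero σ ht
  have := hx.joint
  have hj : HasPDF (fun ω => (Matrix.diagonal t * σ.permMatrix ℝ).mulVec (x ω) + b) P volume :=
    hasPDF_comp_measurableEmbedding (measurableEmbedding_mulVec_add hM b)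
      (map_mulVec_add_volume hM b)
  refine ⟨hj, hasPDF_comp, ?_⟩
  rw [← memLp_comp_iff_of_map_eq_smul (measurableEmbedding_mulVec_add hM b)
    (ofReal_abs_inv_ne_zero hM) ENNReal.ofReal_ne_top (map_mulVec_add_volume hM b)]
  exact (hx.memLp.const_mul _).ae_eq ((functionDifference_scale σ ht b).mono fun u hu => hu.symm)

/-- Inside the integral the density factor contributes `|det| ^ (-p)` and the change of variables
`|det|`; the `p`-th root of the product gives the exponent. -/
lemma fdNorm_scale (hp : 1 ≤ p) [HasPDF x P volume] (σ : Equiv.Perm (Fin n)) (ht : ∀ i, t i ≠ 0)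
    (b : Fin n → ℝ) :
    fdNorm p P (fun ω => (Matrix.diagonal t * σ.permMatrix ℝ).mulVec (x ω) + b)
      = |(Matrix.diagonal t * σ.permMatrix ℝ).det| ^ ((1 - p) / p) * fdNorm p P x := by
  have hM := det_diagonal_mul_permMatrix_ne_zero σ ht
  have hpos : 0 < |(Matrix.diagonal t * σ.permMatrix ℝ).det| := abs_pos.2 hM
  have hs := functionDifference_scale (P := P) (x := x) σ ht b
  have hemb := measurableEmbedding_mulVec_add hM b
  have hvol := map_mulVec_add_volume hM b
  set κ := |(Matrix.diagonal t * σ.permMatrix ℝ).det| with hκ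
  set Δ := functionDifference P fun ω => (Matrix.diagonal t * σ.permMatrix ℝ).mulVec (x ω) + b
  have h1 : κ⁻¹ * ∫ u, |Δ u| ^ p = ∫ u, (κ⁻¹ * |functionDifference P x u|) ^ p := by
    have h2 := hemb.integral_map (μ := volume) fun u => |Δ u| ^ p
    rw [hvol, integral_smul_measure, ENNReal.toReal_ofReal (abs_nonneg _), abs_inv, smul_eq_mul]
      at h2
    rw [h2]
    refine integral_congr_ae ?_
    filter_upwards [hs] with u hu
    rw [hu, abs_mul, abs_of_pos (inv_pos.2 hpos)]
  simp_rw [Real.mul_rpow (inv_pos.2 hpos).le (abs_nonneg _)] at h1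
  rw [integral_const_mul] at h1
  have hp0 : p ≠ 0 := by linarith
  have h3 : ∫ u, |Δ u| ^ p = κ ^ (1 - p) * ∫ u, |functionDifference P x u| ^ p := by
    rw [Real.rpow_sub hpos, Real.rpow_one]
    rw [Real.inv_rpow hpos.le] at h1
    field_simp at h1 ⊢
    exact h1
  rw [fdNorm, fdNorm, h3, Real.mul_rpow (by positivity) (integral_nonneg fun u => by positivity),
    ← Real.rpow_mul hpos.le, mul_one_div]

end Scaling

end BSS

/-! ### Mixtures of sources and the contrast without normalization. -/

namespace BSS

open scoped ENNReal

section Mixtures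

variable {n : ℕ} {Ω : Type*} {x : Ω → Fin n → ℝ}

lemma comp_mix (H : LinearFilter n) (x : Ω → Fin n → ℝ) (i : Fin n) :
    comp (mix H x) i = fun ω => ∑ j, (H : Matrix (Fin n) (Fin n) ℝ) i j * comp x j ω := rfl

lemma mix_mem_mixtures {S : Set (Ω → Fin n → ℝ)} (H : LinearFilter n) (hx : x ∈ mixtures S) :
    mix H x ∈ mixtures S := by
  obtain ⟨K, s, hs, rfl⟩ := hx
  exact ⟨H * K, s, hs, mix_mix H K⟩

lemma mem_mixtures_of_mem {S : Set (Ω → Fin n → ℝ)} (hx : x ∈ S) : x ∈ mixtures S :=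
  ⟨1, x, hx, mix_one.symm⟩

variable [MeasurableSpace Ω] {P : Measure Ω} {p : ℝ}

lemma mixtures_sourcesL2_subset : mixtures (sourcesL2 n p P) ⊆ mixtures (sources n p P) := by
  rintro _ ⟨H, s, hs, rfl⟩
  exact ⟨H, s, hs.1, rfl⟩

lemma memLp_two_of_mem_mixtures (hx : x ∈ mixtures (sourcesL2 n p P)) (i : Fin n) :
    MemLp (comp x i) 2 P := by
  obtain ⟨H, s, hs, rfl⟩ := hx
  rw [comp_mix]
  exact memLp_finsetSum _ fun j _ => (hs.2 j).const_mul _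

/-- Presents normalization as a diagonal scaling with `σ = 1` plus a translation, so that the
scaling lemmas apply to it. -/
lemma normalize_eq (x : Ω → Fin n → ℝ) : normalize P x = fun ω =>
    (Matrix.diagonal (fun i => (Real.sqrt Var[comp x i; P])⁻¹)
      * (1 : Equiv.Perm (Fin n)).permMatrix ℝ).mulVec (x ω)
      + fun i => -(∫ ω', comp x i ω' ∂P) / Real.sqrt Var[comp x i; P] := by
  ext ω i
  rw [Pi.add_apply, diagonal_mul_permMatrix_mulVec, normalize, Equiv.Perm.one_apply]
  ring

end Mixtures

section Sources

variable {n : ℕ} {Ω : Type*} [MeasurableSpace Ω] {P : Measure Ω} [IsProbabilityMeasure P]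
  {s x : Ω → Fin n → ℝ} {p : ℝ}

lemma IsSource.hasPDF_joint (hs : IsSource p P s) : HasPDF s P volume :=
  hasPDF_of_iIndepFun hs.hasPDF hs.indep

lemma IsSource.memLp_joint (hp : 1 ≤ p) (hs : IsSource p P s) :
    MemLp (fun u => (pdf s P volume u).toReal) (ENNReal.ofReal p) volume := by
  have := hs.hasPDF_joint
  have h := (pdf.eq_of_map_eq_withDensity _ measurable_prod_pdf.ennreal_ofReal.aemeasurable).1
    ((iIndepFun_iff_map_eq_withDensity hs.hasPDF).1 hs.indep)
  refine (memLp_prod_eval hp hs.memLp).ae_eq ?_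
  filter_upwards [h] with u hu
  rw [hu, ENNReal.toReal_ofReal (Finset.prod_nonneg fun i _ => ENNReal.toReal_nonneg)]

/-- A row of an invertible matrix has a non-zero entry; the corresponding scaled source has an `Lᵖ`
density and the remaining sum is independent of it. -/
lemma IsSource.memLp_comp_mix (hp : 1 ≤ p) (hs : IsSource p P s) (H : LinearFilter n) (i : Fin n) :
    MemLp (fun u => (pdf (comp (mix H s) i) P volume u).toReal) (ENNReal.ofReal p) volume := by
  set A : Matrix (Fin n) (Fin n) ℝ := (H : Matrix (Fin n) (Fin n) ℝ)
  have hdet : A.det ≠ 0 := Matrix.GeneralLinearGroup.det_ne_zero H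
  have hrow : ∃ j, A i j ≠ 0 := by
    by_contra! h0
    exact hdet (Matrix.det_eq_zero_of_row_eq_zero i h0)
  obtain ⟨j, hj⟩ := hrow
  have hpdf := hs.hasPDF
  have hm (l : Fin n) : AEMeasurable (comp s l) P := HasPDF.aemeasurable (comp s l) P volume
  have hemb := measurableEmbedding_mul_add hj 0
  have hvol := map_mul_add_volume hj 0
  have hX : HasPDF (fun ω => A i j * comp s j ω + 0) P volume :=
    hasPDF_comp_measurableEmbedding hemb hvol
  have hXp := memLp_pdf_comp_measurableEmbedding (hm j) hemb (ofReal_abs_inv_ne_zero hj)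
    ENNReal.ofReal_ne_top hvol (hs.memLp j)
  simp only [add_zero] at hX hXp
  have hind : iIndepFun (fun l ω => A i l * comp s l ω) P :=
    hs.indep.comp (fun l x => A i l * x) fun l => by fun_prop
  have hXZ := (hind.indepFun_finsetSum_of_notMem₀ (fun l => (hm l).const_mul _)
    (Finset.notMem_erase j Finset.univ)).symm
  have h := memLp_pdf_add hXZ (Finset.aemeasurable_sum _ fun l _ => (hm l).const_mul _) hp hXp
  have e : comp (mix H s) i = (fun ω => A i j * comp s j ω)
      + ∑ l ∈ Finset.univ.erase j, fun ω => A i l * comp s l ω := by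
    rw [Finset.add_sum_erase Finset.univ (fun l ω => A i l * comp s l ω) (Finset.mem_univ j),
      comp_mix]
    ext ω
    rw [Finset.sum_apply]
  rw [e]
  exact h

lemma hasFiniteFD_of_mem_mixtures (hp : 1 ≤ p) (hx : x ∈ mixtures (sources n p P)) :
    HasFiniteFD p P x := by
  obtain ⟨H, s, hs, rfl⟩ := hx
  have hs : IsSource p P s := hs
  have := hs.hasPDF_joint
  have := hasPDF_mix (x := s) (P := P) H
  refine hasFiniteFD_of_memLp hp ?_ (hs.memLp_comp_mix hp H)
  have hdet := Matrix.GeneralLinearGroup.det_ne_zero H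
  have h := memLp_pdf_comp_measurableEmbedding (HasPDF.aemeasurable s P volume)
    (measurableEmbedding_mulVec_add hdet 0) (ofReal_abs_inv_ne_zero hdet) ENNReal.ofReal_ne_top
    (map_mulVec_add_volume hdet 0) (hs.memLp_joint hp)
  simp only [add_zero] at h
  exact h

/-- A filter that produces independent components from a source vector is trivial. -/
lemma IsSource.mem_trivialFilters (hs : IsSource p P s) {H : LinearFilter n}
    (h : iIndepFun (fun i => comp (mix H s) i) P) : H ∈ trivialFilters n := by
  have hpdf := hs.hasPDF
  have hdet : IsUnit (H : Matrix (Fin n) (Fin n) ℝ).det :=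
    (Matrix.GeneralLinearGroup.det_ne_zero H).isUnit
  exact exists_perm_eq_diagonal_mul_permMatrix hdet fun i j k hi hk =>
    eq_of_iIndepFun_mixture hdet (fun l => HasPDF.aemeasurable (comp s l) P volume) hs.indep h
      hs.gaussian (fun l c => map_ne_dirac c) hi hk

lemma IsSource.fdNorm_eq_zero (hp : 1 ≤ p) (hs : IsSource p P s) : fdNorm p P s = 0 := by
  have := hs.hasPDF_joint
  exact fdNorm_eq_zero_of_iIndepFun hp hs.indep

lemma fdNorm_mix_trivialFilter (hp : 1 ≤ p) [HasPDF x P volume] {T : LinearFilter n}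
    (hT : T ∈ trivialFilters n) :
    fdNorm p P (mix T x)
      = |(T : Matrix (Fin n) (Fin n) ℝ).det| ^ ((1 - p) / p) * fdNorm p P x := by
  obtain ⟨σ, t, ht, hTe⟩ := hT
  have h := fdNorm_scale (P := P) (x := x) hp σ ht 0
  simp only [add_zero, ← hTe] at h
  exact h

theorem isRelativeContrast_rawContrast (hp : 1 ≤ p) :
    IsRelativeContrast P (sources n p P) (trivialFilters n)
      (fun T => |(T : Matrix (Fin n) (Fin n) ℝ).det| ^ ((1 - p) / p)) (rawContrast p P) := by
  have hrel : ∀ x ∈ mixtures (sources n p P), ∀ t ∈ trivialFilters n, rawContrast p P t x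
      = |(t : Matrix (Fin n) (Fin n) ℝ).det| ^ ((1 - p) / p) * rawContrast p P 1 x := by
    intro x hx t ht
    have := (hasFiniteFD_of_mem_mixtures hp hx).joint
    rw [rawContrast, rawContrast, fdNorm_mix_trivialFilter hp ht, mix_one, mul_neg]
  have hzero : ∀ s ∈ sources n p P, rawContrast p P 1 s = 0 := fun s hs => by
    rw [rawContrast, mix_one, IsSource.fdNorm_eq_zero hp hs, neg_zero]
  refine ⟨dependsOnlyOnPDF_rawContrast p fun x hx => (hasFiniteFD_of_mem_mixtures hp hx).joint,
    hrel, ?_, ?_, ?_⟩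
  · intro s hs t ht
    rw [hrel s (mem_mixtures_of_mem hs) t ht, hzero s hs, mul_zero]
  · intro s hs H
    rw [hzero s hs]
    exact neg_nonpos.2 fdNorm_nonneg
  · intro s hs H h
    rw [hzero s hs, rawContrast, neg_eq_zero] at h
    exact IsSource.mem_trivialFilters hs (iIndepFun_of_fdNorm_eq_zero hp
      (hasFiniteFD_of_mem_mixtures hp ⟨H, s, hs, rfl⟩) h)

end Sources

/-! ### The contrast with normalization. -/

section Normalize

variable {n : ℕ} {Ω : Type*} [MeasurableSpace Ω] {P : Measure Ω} [IsProbabilityMeasure P]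
  {x : Ω → Fin n → ℝ} {p : ℝ}

lemma variance_pos_of_hasPDF {X : Ω → ℝ} [HasPDF X P volume] (hX : MemLp X 2 P) :
    0 < Var[X; P] := by
  refine (variance_nonneg X P).lt_of_ne' fun h => ?_
  have hc : P.map X = P.map fun _ => P[X] := Measure.map_congr (ae_eq_integral_of_variance_eq_zero hX h)
  rw [Measure.map_const, measure_univ, one_smul] at hc
  exact map_ne_dirac _ hc

lemma inv_sqrt_variance_ne_zero (hx : x ∈ mixtures (sourcesL2 n p P)) (hp : 1 ≤ p) (i : Fin n) :
    (Real.sqrt Var[comp x i; P])⁻¹ ≠ 0 := by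
  have := (hasFiniteFD_of_mem_mixtures hp (mixtures_sourcesL2_subset hx)).marginal i
  exact inv_ne_zero (Real.sqrt_pos.2
    (variance_pos_of_hasPDF (memLp_two_of_mem_mixtures hx i))).ne'

lemma hasFiniteFD_normalize (hp : 1 ≤ p) (hx : x ∈ mixtures (sourcesL2 n p P)) :
    HasFiniteFD p P (normalize P x) := by
  rw [normalize_eq]
  exact hasFiniteFD_scale (hasFiniteFD_of_mem_mixtures hp (mixtures_sourcesL2_subset hx)) 1
    (inv_sqrt_variance_ne_zero hx hp) _

lemma fdNorm_normalize (hp : 1 ≤ p) (hx : x ∈ mixtures (sourcesL2 n p P)) :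
    fdNorm p P (normalize P x)
      = (∏ i, (Real.sqrt Var[comp x i; P])⁻¹) ^ ((1 - p) / p) * fdNorm p P x := by
  have := (hasFiniteFD_of_mem_mixtures hp (mixtures_sourcesL2_subset hx)).joint
  rw [normalize_eq, fdNorm_scale hp 1 (inv_sqrt_variance_ne_zero hx hp),
    abs_det_diagonal_mul_permMatrix]
  simp_rw [abs_of_nonneg (inv_nonneg.2 (Real.sqrt_nonneg _))]

/-- The standard deviation of component `i` of `Tx` is `|t i|` times that of `x (σ i)`, so the
normalizing factors absorb exactly `|det T|`. -/
lemma fdNorm_normalize_mix_trivialFilter (hp : 1 ≤ p) (hx : x ∈ mixtures (sourcesL2 n p P))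
    {T : LinearFilter n} (hT : T ∈ trivialFilters n) :
    fdNorm p P (normalize P (mix T x)) = fdNorm p P (normalize P x) := by
  have := (hasFiniteFD_of_mem_mixtures hp (mixtures_sourcesL2_subset hx)).joint
  rw [fdNorm_normalize hp hx, fdNorm_normalize hp (mix_mem_mixtures T hx),
    fdNorm_mix_trivialFilter hp hT, ← mul_assoc, ← Real.mul_rpow
      (Finset.prod_nonneg fun i _ => inv_nonneg.2 (Real.sqrt_nonneg _)) (abs_nonneg _)]
  obtain ⟨σ, t, ht, hTe⟩ := hT
  have hcomp (i : Fin n) : comp (mix T x) i = fun ω => t i * comp x (σ i) ω := by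
    ext ω
    rw [comp, mix, hTe, diagonal_mul_permMatrix_mulVec, comp]
  rw [hTe, abs_det_diagonal_mul_permMatrix, ← Finset.prod_mul_distrib,
    ← Equiv.prod_comp σ fun i => (Real.sqrt Var[comp x i; P])⁻¹]
  congr 3 with i
  rw [hcomp, variance_const_mul, Real.sqrt_mul (sq_nonneg _), Real.sqrt_sq_eq_abs]
  have := abs_ne_zero.2 (ht i)
  field_simp

theorem isContrast_normalizedContrast (hp : 1 ≤ p) :
    IsContrast P (sourcesL2 n p P) (trivialFilters n) (normalizedContrast p P) := by
  have hzero : ∀ s ∈ sourcesL2 n p P, normalizedContrast p P 1 s = 0 := fun s hs => by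
    rw [normalizedContrast, mix_one, fdNorm_normalize hp (mem_mixtures_of_mem hs),
      IsSource.fdNorm_eq_zero hp hs.1, mul_zero, neg_zero]
  refine ⟨dependsOnlyOnPDF_normalizedContrast p fun x hx =>
    (hasFiniteFD_of_mem_mixtures hp (mixtures_sourcesL2_subset hx)).joint, ?_, ?_, ?_⟩
  · intro x hx t ht
    rw [normalizedContrast, normalizedContrast, fdNorm_normalize_mix_trivialFilter hp hx ht,
      mix_one]
  · intro s hs H
    rw [hzero s hs]
    exact neg_nonpos.2 fdNorm_nonneg
  · intro s hs H h
    have hmem : mix H s ∈ mixtures (sourcesL2 n p P) := ⟨H, s, hs, rfl⟩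
    -- Normalization only multiplies the norm by a positive factor, so the unnormalized norm
    -- vanishes too.
    rw [hzero s hs, normalizedContrast, neg_eq_zero, fdNorm_normalize hp hmem] at h
    have hpos : 0 < ∏ i, (Real.sqrt Var[comp (mix H s) i; P])⁻¹ :=
      Finset.prod_pos fun i _ => (inv_nonneg.2 (Real.sqrt_nonneg _)).lt_of_ne'
        (inv_sqrt_variance_ne_zero hmem hp i)
    exact hs.1.mem_trivialFilters (iIndepFun_of_fdNorm_eq_zero hp
      (hasFiniteFD_of_mem_mixtures hp (mixtures_sourcesL2_subset hmem))
      ((mul_eq_zero.1 h).resolve_left (Real.rpow_pos_of_pos hpos _).ne'))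

end Normalize

end BSS

theorem mainTheorem9 {Ω : Type*} [MeasurableSpace Ω] (P : Measure Ω) [IsProbabilityMeasure P]
    (n : ℕ) (hn : 2 ≤ n) (p : ℝ) (hp : 1 ≤ p) :
    -- with normalization: finite, and a contrast
    ((∀ x ∈ BSS.mixtures (BSS.sourcesL2 n p P), BSS.HasFiniteFD p P (BSS.normalize P x)) ∧
      BSS.IsContrast P (BSS.sourcesL2 n p P) (BSS.trivialFilters n)
        (BSS.normalizedContrast p P)) ∧
    -- without normalization: finite, and a contrast up to relative scale invariance
    ((∀ x ∈ BSS.mixtures (BSS.sources n p P), BSS.HasFiniteFD p P x) ∧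
      BSS.IsRelativeContrast P (BSS.sources n p P) (BSS.trivialFilters n)
        (fun T => |(T : Matrix (Fin n) (Fin n) ℝ).det| ^ ((1 - p) / p))
        (BSS.rawContrast p P)) ∧
    -- without normalization, `p = 1`: a contrast in the strict sense
    (p = 1 → BSS.IsContrast P (BSS.sources n p P) (BSS.trivialFilters n)
      (BSS.rawContrast p P)) := by
  refine ⟨⟨fun x hx => BSS.hasFiniteFD_normalize hp hx, BSS.isContrast_normalizedContrast hp⟩,
    ⟨fun x hx => BSS.hasFiniteFD_of_mem_mixtures hp hx, BSS.isRelativeContrast_rawContrast hp⟩, ?_⟩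
  rintro rfl
  have h := BSS.isRelativeContrast_rawContrast (n := n) (P := P) hp
  refine ⟨h.pdf_only, fun x hx t ht => ?_, h.dominance, h.discrimination⟩
  have := h.relative_invariance x hx t ht
  -- At `p = 1` the exponent `(1 - p) / p` is zero, so the scaling factor is `1`.
  simpa using this
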